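/- **Local quadratic convergence of the subspace method for the real stability radius.** *Setting.* Let $A\in\mathbb R^{n\times n}$ be Hurwitz stable (all eigenvalues have negative real part), $B\in\mathbb R^{n\times m}$, $C\in\mathbb R^{p\times n}$, and $H(s)=C(sI-A)^{-1}B$. Fix $\Gamma\in(0,1)$. For a complex matrix $M$ put $$T_M(\gamma)=\begin{bmatrix}\operatorname{Re}M&-\gamma\operatorname{Im}M\\ \gamma^{-1}\operatorname{Im}M&\operatorname{Re}M\end{bmatrix},\qquad \mu(M)=\inf_{\gamma\in[\Gamma,1]}\sigma_2\big(T_M(\gamma)\big),$$ where $\sigma_1\ge\sigma_2\ge\dots$ are the singular values. Write $\mu(\omega)=\mu(H(i\omega))$ and $\sigma_2(\omega,\gamma)=\sigma_2(T_{H(i\omega)}(\gamma))$ for $\omega\in\mathbb R$. For a matrix $V\in\mathbb C^{n\times r}$ with orthonormal columns put $A^V=V^*AV$, $H^V(s)=CV(sI-A^V)^{-1}V^*B$ and $\mu^V(\omega)=\mu(H^V(i\omega))$ for those real $\omega$ for which $i\omega I-A^V$ is invertible. *Algorithm.* Given $\omega_1\in\mathbb R$, let the columns of $V_1$ be an orthonormal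 basis of the column space of $W(\omega_1)$, where $$W(\omega)=\big[(i\omega I-A)^{-1}B\;\;(i\omega I-A)^{-2}B\;\;(i\omega I-A)^{-3}B\big].$$ For $k=1,2,\dots$ let $\omega_{k+1}$ be a global maximizer of $\mu^{V_k}$ over $\mathbb R$, and let the columns of $V_{k+1}$ be an orthonormal basis of the column space of $[V_k\;\;W(\omega_{k+1})]$. *Theorem.* Let $\omega_*$ be a local maximizer of $\mu(\omega)$, let $\gamma_*$ be the unique minimizer of $\sigma_2(\omega_*,\cdot)$ over $[\Gamma,1]$, and let $\beta>0$. Assume that $\sigma_2(\omega_*,\gamma_*)$ is a simple singular value of $T_{H(i\omega_*)}(\gamma_*)$ and that $\mu''(\omega_*)\neq0$ (in particular, $\mu''(\omega_*)$ exists). Then there are constants $c>0$ and $\delta>0$, depending only on $A,B,C,\Gamma,\omega_*,\gamma_*,\beta$, such that for every run of the algorithm (of finite or infinite length, with any choice of $\omega_1$, of the maximizers and of the orthonormal bases) and every iteration $k\ge1$ of it for which $$\sigma_{\min}\big(i\omega_*I-A^{V_k}\big)\ge\beta,\qquad|\omega_k-\omega_*|<\delta,\qquad|\omega_{k+1}-\omega_*|<\delta,$$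 one has $$|\omega_{k+1}-\omega_*|\le c\,|\omega_k-\omega_*|^2 .$$ -/

import Mathlib

open scoped Matrix

noncomputable section

namespace StabRadius

/-- `sigma M i` is the `i`-th singular value `σ_i(M)` of `M`, in non-increasing order and with
multiplicity, for `1 ≤ i ≤ min (rows) (columns)`. -/
def sigma {𝕜 : Type*} [RCLike 𝕜] {a b : Type*} [Fintype a] [DecidableEq a] [Fintype b]
    [DecidableEq b] (M : Matrix a b 𝕜) (i : ℕ) : ℝ :=
  (Matrix.toEuclideanLin M).singularValues (i - 1)

/-- The smallest singular value of a square matrix. -/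
def sigmaMin {𝕜 : Type*} [RCLike 𝕜] {a : Type*} [Fintype a] [DecidableEq a]
    (M : Matrix a a 𝕜) : ℝ :=
  sigma M (Fintype.card a)

/-- The singular value `σ_j(M)` exists and is simple: none of the other singular values
`σ_i(M)`, `1 ≤ i ≤ min (rows) (columns)`, is equal to it. -/
def IsSimpleSingularValue {𝕜 : Type*} [RCLike 𝕜] {a b : Type*} [Fintype a] [DecidableEq a]
    [Fintype b] [DecidableEq b] (M : Matrix a b 𝕜) (j : ℕ) : Prop :=
  j ∈ Finset.Icc 1 (min (Fintype.card a) (Fintype.card b)) ∧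
    ∀ i ∈ Finset.Icc 1 (min (Fintype.card a) (Fintype.card b)), i ≠ j → sigma M i ≠ sigma M j

/-- A real matrix, viewed as a complex matrix. -/
def toC {a b : Type*} (M : Matrix a b ℝ) : Matrix a b ℂ := M.map Complex.ofReal

/-- All the eigenvalues of the real square matrix `A` lie in the open left half plane. -/
def IsHurwitz {n : ℕ} (A : Matrix (Fin n) (Fin n) ℝ) : Prop :=
  ∀ z ∈ spectrum ℂ (toC A), z.re < 0

/-- `D(iω) = iω I - A`. -/
def shifted {n : ℕ} (A : Matrix (Fin n) (Fin n) ℂ) (ω : ℝ) : Matrix (Fin n) (Fin n) ℂ :=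
  (Complex.I * (ω : ℂ)) • (1 : Matrix (Fin n) (Fin n) ℂ) - A

/-- The transfer function on the imaginary axis, `H(iω) = C (iω I - A)⁻¹ B`. -/
def transfer {n m p : ℕ} (A : Matrix (Fin n) (Fin n) ℂ) (B : Matrix (Fin n) (Fin m) ℂ)
    (C : Matrix (Fin p) (Fin n) ℂ) (ω : ℝ) : Matrix (Fin p) (Fin m) ℂ :=
  C * (shifted A ω)⁻¹ * B

/-- The real block matrix `[Re M, -γ Im M; γ⁻¹ Im M, Re M]`. -/
def blockT {m p : ℕ} (M : Matrix (Fin p) (Fin m) ℂ) (γ : ℝ) :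
    Matrix (Fin p ⊕ Fin p) (Fin m ⊕ Fin m) ℝ :=
  Matrix.fromBlocks (M.map Complex.re) (-(γ • M.map Complex.im))
    (γ⁻¹ • M.map Complex.im) (M.map Complex.re)

/-- `μ(M) = inf_{γ ∈ [Γ, 1]} σ₂([Re M, -γ Im M; γ⁻¹ Im M, Re M])`. -/
def mu {m p : ℕ} (Γ : ℝ) (M : Matrix (Fin p) (Fin m) ℂ) : ℝ :=
  sInf ((fun γ : ℝ => sigma (blockT M γ) 2) '' Set.Icc Γ 1)

/-- `V` is a value of `orth(M)`: its columns form an orthonormal basis of the column space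
of `M`. -/
def IsOrth {n r : ℕ} {b : Type*} [Fintype b] (V : Matrix (Fin n) (Fin r) ℂ)
    (M : Matrix (Fin n) b ℂ) : Prop :=
  Vᴴ * V = 1 ∧ LinearMap.range V.mulVecLin = LinearMap.range M.mulVecLin

/-- The matrix `[(iωI - A)⁻¹ B, (iωI - A)⁻² B, (iωI - A)⁻³ B]`. -/
def interpBlock {n m : ℕ} (A : Matrix (Fin n) (Fin n) ℂ) (B : Matrix (Fin n) (Fin m) ℂ) (ω : ℝ) :
    Matrix (Fin n) (Fin m ⊕ (Fin m ⊕ Fin m)) ℂ :=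
  Matrix.fromCols ((shifted A ω)⁻¹ * B)
    (Matrix.fromCols ((shifted A ω)⁻¹ ^ 2 * B) ((shifted A ω)⁻¹ ^ 3 * B))

/-- The projected matrix `A^V = V* A V`. -/
def projA {n r : ℕ} (A : Matrix (Fin n) (Fin n) ℂ) (V : Matrix (Fin n) (Fin r) ℂ) :
    Matrix (Fin r) (Fin r) ℂ :=
  Vᴴ * A * V

/-- The reduced transfer function `H^V(iω) = (C V) (iω I - V* A V)⁻¹ (V* B)`. -/
def reducedTransfer {n m p r : ℕ} (A : Matrix (Fin n) (Fin n) ℂ) (B : Matrix (Fin n) (Fin m) ℂ)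
    (C : Matrix (Fin p) (Fin n) ℂ) (V : Matrix (Fin n) (Fin r) ℂ) (ω : ℝ) :
    Matrix (Fin p) (Fin m) ℂ :=
  transfer (projA A V) (Vᴴ * B) (C * V) ω

/-- `ωhat` is a global maximizer of the reduced function `μ^V(ω) = μ(H^V(iω))`, which is defined
for those real `ω` for which `iω I - A^V` is invertible. -/
def IsReducedMaximizer {n m p r : ℕ} (Γ : ℝ) (A : Matrix (Fin n) (Fin n) ℂ)
    (B : Matrix (Fin n) (Fin m) ℂ) (C : Matrix (Fin p) (Fin n) ℂ) (V : Matrix (Fin n) (Fin r) ℂ)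
    (ωhat : ℝ) : Prop :=
  IsUnit (shifted (projA A V) ωhat) ∧
    ∀ ω : ℝ, IsUnit (shifted (projA A V) ω) →
      mu Γ (reducedTransfer A B C V ω) ≤ mu Γ (reducedTransfer A B C V ωhat)

/-- `N` iterations of the subspace method: `ω 1` is arbitrary, `V 1` is an orthonormalization of
the interpolation block at `ω 1`; for `k = 1, …, N`, the next iterate `ω (k + 1)` is a global
maximizer of the reduced function of `V k`, and `V k` is then expanded to an orthonormalization
`V (k + 1)` of `V k` together with the interpolation block at `ω (k + 1)`. -/
structure IsSubspaceRun {n m p : ℕ} (Γ : ℝ) (A : Matrix (Fin n) (Fin n) ℂ)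
    (B : Matrix (Fin n) (Fin m) ℂ) (C : Matrix (Fin p) (Fin n) ℂ) (N : ℕ)
    (r : ℕ → ℕ) (V : (k : ℕ) → Matrix (Fin n) (Fin (r k)) ℂ) (ω : ℕ → ℝ) : Prop where
  init : IsOrth (V 1) (interpBlock A B (ω 1))
  maximize : ∀ k, 1 ≤ k → k ≤ N → IsReducedMaximizer Γ A B C (V k) (ω (k + 1))
  expand : ∀ k, 1 ≤ k → k ≤ N →
    IsOrth (V (k + 1)) (Matrix.fromCols (V k) (interpBlock A B (ω (k + 1))))

end StabRadius

end

/-! Put h = |ω_k - ω_*|, e = |ω_{k+1} - ω_*|, M₀ = H(iω_*), M₁ = H(iω_{k+1}), and let F and E be the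
errors H^V - H at ω_* and at ω_{k+1}.

Interpolation. The range of V_k contains the first three powers of the resolvent at ω_k applied to
B, so H^V - H has a triple zero at ω_k with a cofactor bounded uniformly in V
(`reducedTransfer_sub_transfer`). Hence ‖F‖ = O(h³) and ‖E - F‖ = O((h + e)² e + h³ e)
(`exists_transfer_error_bounds`).

Comparison. Maximality of ω_{k+1} says μ(M₀ + F) ≤ μ(M₁ + E). Testing the infima at minimizers γ₁
for M₁ and γ₀ for M₀ + F bounds μ(M₀) - μ(M₁) by a difference of two increments of (M, γ) ↦
σ₂(T_M(γ)). This map is C² near (M₀, γ_*) because σ₂ is simple and positive there, so the difference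
is at most a constant times ‖E - F‖ + ‖F‖ (‖M₁ - M₀‖ + |γ₀ - γ_*| + |γ₁ - γ_*|)
(`exists_four_point_bound`, `exists_mu_sub_le`). Smoothness of the reduced function is never needed.

Nondegeneracy in γ. The minimizers move by at most the square root of the perturbation, since γ ↦
σ₂(T_{M₀}(γ)) grows quadratically at γ_* (`exists_quadratic_growth`). This is automatic: conjugation
by diag(1, γ⁻¹) turns the forms |T_M(γ)x|² - σ²|x|² into a pencil linear in γ², and a simple σ₂
provides a kernel vector z of it. If z is not isotropic for the derivative of the pencil, then σ₂
has nonzero slope, which for a minimizer means the endpoint Γ. If z is isotropic, an explicit plane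
close to z and iz shows that σ₂ has strictly positive second order growth
(`exists_pencil_quadratic_growth`).

Conclusion. Since ω_* is a local maximizer with nonzero second derivative, μ(M₀) - μ(M₁) ≥ c e²
(`exists_quadratic_decay`). Together these give e² ≲ h² e + h⁴ + e³, hence e ≲ h² once e is small
(`exists_quadratic_rate`). -/

noncomputable section
namespace StabRadius

open Module InnerProductSpace Filter Topology

/-! ### Singular values and right singular vectors -/

section SingularValues

variable {𝕜 : Type*} [RCLike 𝕜]
  {E : Type*} [NormedAddCommGroup E] [InnerProductSpace 𝕜 E] [FiniteDimensional 𝕜 E]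
  {F : Type*} [NormedAddCommGroup F] [InnerProductSpace 𝕜 F] [FiniteDimensional 𝕜 F]

/-- An eigenbasis of `T† T`, ordered as the singular values of `T`. -/
def rightBasis (T : E →ₗ[𝕜] F) : OrthonormalBasis (Fin (finrank 𝕜 E)) 𝕜 E :=
  T.isSymmetric_adjoint_comp_self.eigenvectorBasis rfl

theorem adjoint_comp_rightBasis (T : E →ₗ[𝕜] F) (i : Fin (finrank 𝕜 E)) :
    LinearMap.adjoint T (T (rightBasis T i)) =
      ((T.singularValues i ^ 2 : ℝ) : 𝕜) • rightBasis T i := by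
  rw [T.sq_singularValues_fin rfl]
  exact T.isSymmetric_adjoint_comp_self.apply_eigenvectorBasis rfl i

theorem inner_rightBasis_adjoint_comp (T : E →ₗ[𝕜] F) (i : Fin (finrank 𝕜 E)) (v : E) :
    inner 𝕜 (rightBasis T i) (LinearMap.adjoint T (T v)) =
      ((T.singularValues i ^ 2 : ℝ) : 𝕜) * inner 𝕜 (rightBasis T i) v := by
  have h := T.isSymmetric_adjoint_comp_self (rightBasis T i) v
  simp only [LinearMap.comp_apply, adjoint_comp_rightBasis, inner_smul_left] at h
  rw [← h]; simp

theorem norm_sq_apply_eq_sum (T : E →ₗ[𝕜] F) (v : E) :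
    ‖T v‖ ^ 2 =
      ∑ i : Fin (finrank 𝕜 E), T.singularValues i ^ 2 * ‖inner 𝕜 (rightBasis T i) v‖ ^ 2 := by
  have h1 : ((‖T v‖ ^ 2 : ℝ) : 𝕜) = inner 𝕜 v (LinearMap.adjoint T (T v)) := by
    rw [LinearMap.adjoint_inner_right, inner_self_eq_norm_sq_to_K]; push_cast; rfl
  have h2 := (rightBasis T).sum_inner_mul_inner v (LinearMap.adjoint T (T v))
  have h3 : ((‖T v‖ ^ 2 : ℝ) : 𝕜) =
      ((∑ i : Fin (finrank 𝕜 E), T.singularValues i ^ 2 * ‖inner 𝕜 (rightBasis T i) v‖ ^ 2 : ℝ) : 𝕜) := by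
    rw [h1, ← h2, RCLike.ofReal_sum]
    refine Finset.sum_congr rfl fun i _ => ?_
    rw [inner_rightBasis_adjoint_comp, ← inner_conj_symm v]
    have := RCLike.conj_mul (inner 𝕜 (rightBasis T i) v)
    push_cast
    linear_combination ((T.singularValues i : ℝ) : 𝕜) ^ 2 * this
  exact_mod_cast h3

theorem norm_apply_rightBasis (T : E →ₗ[𝕜] F) (i : Fin (finrank 𝕜 E)) :
    ‖T (rightBasis T i)‖ = T.singularValues i := by
  have : ‖T (rightBasis T i)‖ ^ 2 = T.singularValues i ^ 2 := by
    rw [norm_sq_apply_eq_sum, Finset.sum_eq_single i]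
    · simp
    · intro j _ hj
      simp [(rightBasis T).inner_eq_ite, hj]
    · simp
  exact (pow_left_inj₀ (norm_nonneg _) (T.singularValues_nonneg _) two_ne_zero).1 this

theorem singularValues_last_mul_norm_le (T : E →ₗ[𝕜] F) (v : E) :
    T.singularValues (finrank 𝕜 E - 1) * ‖v‖ ≤ ‖T v‖ := by
  refine le_of_sq_le_sq ?_ (norm_nonneg _)
  rw [mul_pow, norm_sq_apply_eq_sum, ← (rightBasis T).sum_sq_norm_inner_right v, Finset.mul_sum]
  refine Finset.sum_le_sum fun i _ => mul_le_mul_of_nonneg_right ?_ (sq_nonneg _)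
  exact pow_le_pow_left₀ (T.singularValues_nonneg _) (T.singularValues_antitone (by omega)) 2

end SingularValues

/-! ### Variational bounds for the second singular value -/

section SecondSingularValue

variable {E : Type*} [NormedAddCommGroup E] [InnerProductSpace ℝ E] [FiniteDimensional ℝ E]
  {F : Type*} [NormedAddCommGroup F] [InnerProductSpace ℝ F] [FiniteDimensional ℝ F]

/-- One half of Courant–Fischer: every plane contains a nonzero vector orthogonal to the first right
singular vector, and on such a vector T stretches by at most σ₂. -/
theorem le_singularValues_one (T : E →ₗ[ℝ] F) {x u : E} (hxu : LinearIndependent ℝ ![x, u])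
    {s : ℝ} (hs : ∀ a b : ℝ, s * ‖a • x + b • u‖ ≤ ‖T (a • x + b • u)‖) :
    s ≤ T.singularValues 1 := by
  have hdim : 1 < finrank ℝ E := by
    have := hxu.fintype_card_le_finrank; simp at this; omega
  let i0 : Fin (finrank ℝ E) := ⟨0, by omega⟩
  obtain ⟨a, b, hab, h0⟩ : ∃ a b : ℝ, (a ≠ 0 ∨ b ≠ 0) ∧
      inner ℝ (rightBasis T i0) (a • x + b • u) = 0 := by
    by_cases h : inner ℝ (rightBasis T i0) u = 0 ∧ inner ℝ (rightBasis T i0) x = 0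
    · exact ⟨1, 0, by simp, by simp [h.2]⟩
    · refine ⟨inner ℝ (rightBasis T i0) u, - inner ℝ (rightBasis T i0) x, ?_, ?_⟩
      · by_contra hc; push Not at hc; exact h ⟨hc.1, by linarith [hc.2]⟩
      · rw [inner_add_right, inner_smul_right, inner_smul_right]; ring
  set v := a • x + b • u with hv
  have hv0 : v ≠ 0 := by
    intro h
    rw [LinearIndependent.pair_iff] at hxu
    obtain ⟨h1, h2⟩ := hxu a b h
    simp [h1, h2] at hab
  have key : ‖T v‖ ≤ T.singularValues 1 * ‖v‖ := by
    refine le_of_sq_le_sq ?_ (mul_nonneg (T.singularValues_nonneg _) (norm_nonneg _))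
    rw [mul_pow, norm_sq_apply_eq_sum, ← (rightBasis T).sum_sq_norm_inner_right v, Finset.mul_sum]
    refine Finset.sum_le_sum fun i _ => ?_
    by_cases hi : i = i0
    · rw [hi, h0]; simp
    · refine mul_le_mul_of_nonneg_right ?_ (sq_nonneg _)
      refine pow_le_pow_left₀ (T.singularValues_nonneg _) (T.singularValues_antitone ?_) 2
      rw [Fin.ext_iff] at hi; simp [i0] at hi; omega
  exact le_of_mul_le_mul_right ((hs a b).trans key) (norm_pos_iff.2 hv0)

theorem norm_sq_smul_rightBasis (T : E →ₗ[ℝ] F) {i j : Fin (finrank ℝ E)} (hij : i ≠ j)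
    (a b : ℝ) : ‖a • rightBasis T i + b • rightBasis T j‖ ^ 2 = a ^ 2 + b ^ 2 := by
  have h : inner ℝ (a • rightBasis T i) (b • rightBasis T j) = 0 := by
    rw [inner_smul_left, inner_smul_right, (rightBasis T).inner_eq_ite, if_neg hij]; simp
  rw [sq, norm_add_sq_eq_norm_sq_add_norm_sq_of_inner_eq_zero _ _ h, norm_smul, norm_smul]
  simp; ring

theorem singularValues_one_mul_norm_le (T : E →ₗ[ℝ] F) (h : 1 < finrank ℝ E) (a b : ℝ) :
    T.singularValues 1 * ‖a • rightBasis T ⟨0, by omega⟩ + b • rightBasis T ⟨1, h⟩‖ ≤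
      ‖T (a • rightBasis T ⟨0, by omega⟩ + b • rightBasis T ⟨1, h⟩)‖ := by
  refine le_of_sq_le_sq ?_ (norm_nonneg _)
  set v := a • rightBasis T ⟨0, by omega⟩ + b • rightBasis T ⟨1, h⟩ with hv
  rw [mul_pow, norm_sq_apply_eq_sum, ← (rightBasis T).sum_sq_norm_inner_right v, Finset.mul_sum]
  refine Finset.sum_le_sum fun i _ => ?_
  by_cases hi : (i : ℕ) ≤ 1
  · refine mul_le_mul_of_nonneg_right ?_ (sq_nonneg _)
    exact pow_le_pow_left₀ (T.singularValues_nonneg _) (T.singularValues_antitone hi) 2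
  · have : inner ℝ (rightBasis T i) v = 0 := by
      rw [hv, inner_add_right, inner_smul_right, inner_smul_right, (rightBasis T).inner_eq_ite,
        (rightBasis T).inner_eq_ite, if_neg, if_neg]
      · simp
      · rintro rfl; simp at hi
      · rintro rfl; simp at hi
    rw [this]; simp

theorem linearIndependent_rightBasis (T : E →ₗ[ℝ] F) (h : 1 < finrank ℝ E) :
    LinearIndependent ℝ ![rightBasis T ⟨0, by omega⟩, rightBasis T ⟨1, h⟩] := by
  rw [LinearIndependent.pair_iff]
  intro a b hab
  have := norm_sq_smul_rightBasis T (i := ⟨0, by omega⟩) (j := ⟨1, h⟩) (by simp) a b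
  rw [hab] at this
  simp at this
  constructor <;> nlinarith [sq_nonneg a, sq_nonneg b]

/-- The plane of the first two right singular vectors of T is a test plane for S. The second
alternative covers dimension at most one, where index 1 only carries the default value 0. -/
theorem singularValues_one_le_add (T S : E →ₗ[ℝ] F) {κ : ℝ}
    (h : ∀ v, ‖(T - S) v‖ ≤ κ * ‖v‖) : T.singularValues 1 - κ ≤ S.singularValues 1 ∨
      finrank ℝ E ≤ 1 := by
  by_cases hd : 1 < finrank ℝ E
  · left
    refine le_singularValues_one S (linearIndependent_rightBasis T hd) fun a b => ?_
    have h1 := singularValues_one_mul_norm_le T hd a b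
    set v := a • rightBasis T ⟨0, by omega⟩ + b • rightBasis T ⟨1, hd⟩ with hv
    have h2 := h v
    have h3 : ‖T v‖ ≤ ‖(T - S) v‖ + ‖S v‖ := by
      have := norm_add_le ((T - S) v) (S v); simpa using this
    linarith
  · right; omega

theorem abs_singularValues_one_sub_le (T S : E →ₗ[ℝ] F) {κ : ℝ} (hκ : 0 ≤ κ)
    (h : ∀ v, ‖(T - S) v‖ ≤ κ * ‖v‖) : |T.singularValues 1 - S.singularValues 1| ≤ κ := by
  have h' : ∀ v, ‖(S - T) v‖ ≤ κ * ‖v‖ := fun v => by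
    rw [← neg_sub, LinearMap.neg_apply, norm_neg]; exact h v
  by_cases hd : finrank ℝ E ≤ 1
  · rw [T.singularValues_of_finrank_le hd, S.singularValues_of_finrank_le hd]; simpa using hκ
  · have h1 := (singularValues_one_le_add T S h).resolve_right hd
    have h2 := (singularValues_one_le_add S T h').resolve_right hd
    rw [abs_le]; constructor <;> linarith

/-- A simple singular value has a one-dimensional space of right singular vectors. -/
theorem eq_smul_rightBasis_of_adjoint_comp (T : E →ₗ[ℝ] F) {j : Fin (finrank ℝ E)}
    (hj : ∀ i : Fin (finrank ℝ E), i ≠ j → T.singularValues i ≠ T.singularValues j) {v : E}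
    (hv : LinearMap.adjoint T (T v) = (T.singularValues j ^ 2) • v) :
    v = (inner ℝ (rightBasis T j) v) • rightBasis T j := by
  conv_lhs => rw [← (rightBasis T).sum_repr' v]
  rw [Finset.sum_eq_single j]
  · intro i _ hi
    have h1 := inner_rightBasis_adjoint_comp T i v
    rw [hv, inner_smul_right] at h1
    have h2 : (T.singularValues j ^ 2 - T.singularValues i ^ 2) *
        inner ℝ (rightBasis T i) v = 0 := by
      rw [sub_mul, h1]; simp
    rcases mul_eq_zero.1 h2 with h3 | h3
    · exfalso
      refine hj i hi ((pow_left_inj₀ (T.singularValues_nonneg _) (T.singularValues_nonneg _)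
        two_ne_zero).1 (by linarith))
    · rw [h3, zero_smul]
  · simp

end SecondSingularValue

/-! ### Implicit functions and second order increments -/

section SmoothRoots

variable {X : Type*} [NormedAddCommGroup X] [NormedSpace ℝ X]

/-- A continuous choice of a simple root of a `C²` equation is `C²`. -/
theorem contDiffAt_of_simple_root [CompleteSpace X] {P : X × ℝ → ℝ} {φ : X → ℝ} {x₀ : X}
    (hP : ContDiff ℝ 2 P) (hφ : ContinuousAt φ x₀) (hroot : ∀ x, P (x, φ x) = 0) {d : ℝ}
    (hd : HasDerivAt (fun t => P (x₀, t)) d (φ x₀)) (hd0 : d ≠ 0) : ContDiffAt ℝ 2 φ x₀ := by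
  have hPa : ContDiffAt ℝ 2 P (x₀, φ x₀) := hP.contDiffAt
  -- The partial derivative in the last variable is multiplication by `d ≠ 0`, which is what the
  -- implicit function theorem asks for.
  have hinv : (fderiv ℝ P (x₀, φ x₀) ∘L .inr ℝ X ℝ).IsInvertible := by
    refine ⟨ContinuousLinearEquiv.unitsEquivAut ℝ (Units.mk0 d hd0), ?_⟩
    ext
    have h1 : HasFDerivAt P (fderiv ℝ P (x₀, φ x₀)) (x₀, φ x₀) :=
      (hPa.differentiableAt (by norm_num)).hasFDerivAt
    have h2 : HasDerivAt (fun t : ℝ => (x₀, t)) ((0 : X), (1 : ℝ)) (φ x₀) :=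
      (hasDerivAt_const _ _).prodMk (hasDerivAt_id _)
    have h3 := h1.comp_hasDerivAt (φ x₀) h2
    have h4 := hd.unique h3
    simp [h4]
  have hev := hPa.eventually_apply_eq_iff_implicitFunction (by norm_num) hinv
  have hc : Tendsto (fun x => (x, φ x)) (𝓝 x₀) (𝓝 (x₀, φ x₀)) :=
    (continuousAt_id.prodMk hφ)
  refine (hPa.contDiffAt_implicitFunction (by norm_num) hinv).congr_of_eventuallyEq ?_
  filter_upwards [hc.eventually hev] with x hx
  exact (hx.1 (by rw [hroot, hroot])).symm

/-- The derivative of a C² function is locally Lipschitz. Two increments therefore differ through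
their steps, by O(‖e - f‖), and through their base points, by O(‖f‖ ‖x - y‖); no term of size ‖f‖
alone survives. -/
theorem exists_four_point_bound {Ψ : X → ℝ} {x₀ : X} (h : ContDiffAt ℝ 2 Ψ x₀) :
    ∃ K > (0 : ℝ), ∃ ρ > (0 : ℝ), ∀ x y e f : X, x ∈ Metric.ball x₀ ρ → y ∈ Metric.ball x₀ ρ →
      x + e ∈ Metric.ball x₀ ρ → y + f ∈ Metric.ball x₀ ρ →
      (Ψ (x + e) - Ψ x) - (Ψ (y + f) - Ψ y) ≤ K * (‖e - f‖ + ‖f‖ * ‖x - y‖) := by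
  have hd1 : ContDiffAt ℝ 1 (fderiv ℝ Ψ) x₀ := h.fderiv_right (by norm_num)
  obtain ⟨κ, t, ht, hlip⟩ := hd1.exists_lipschitzOnWith
  have hdiff : ∀ᶠ x in 𝓝 x₀, DifferentiableAt ℝ Ψ x := by
    filter_upwards [h.eventually (by simp)] with x hx
    exact hx.differentiableAt (by norm_num)
  obtain ⟨ρ, hρ, hball⟩ := Metric.mem_nhds_iff.1 (Filter.inter_mem ht hdiff)
  -- `‖fderiv ℝ Ψ x₀‖ + κ * ρ` bounds the derivative on the ball, `κ * (2 * ρ)` absorbs the product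
  -- ‖e - f‖ ‖f‖ since ‖f‖ ≤ 2ρ, and the last `κ` pays for the shift of base point.
  refine ⟨‖fderiv ℝ Ψ x₀‖ + κ * ρ + κ * (2 * ρ) + κ + 1, by positivity, ρ, hρ, ?_⟩
  intro x y e f hx hy hxe hyf
  have hmem : ∀ {a b : X}, a ∈ Metric.ball x₀ ρ → a + b ∈ Metric.ball x₀ ρ → ∀ s ∈ Set.Icc (0:ℝ) 1,
      a + s • b ∈ Metric.ball x₀ ρ := fun {a b} ha hab s hs => by
    have := (convex_ball x₀ ρ).add_smul_mem ha (y := b) hab hs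
    exact this
  have hf : ‖f‖ ≤ 2 * ρ := by
    have h1 := mem_ball_iff_norm.1 hy
    have h2 := mem_ball_iff_norm.1 hyf
    have : f = (y + f - x₀) - (y - x₀) := by abel
    rw [this]; exact (norm_sub_le _ _).trans (by linarith)
  set D := fderiv ℝ Ψ with hD
  have hDb : ∀ a ∈ Metric.ball x₀ ρ, ‖D a‖ ≤ ‖D x₀‖ + κ * ρ := fun a ha => by
    have h1 := hlip.norm_sub_le (hball ha).1 (hball (Metric.mem_ball_self hρ)).1
    have h2 := mem_ball_iff_norm.1 ha
    have h3 : ‖D a‖ ≤ ‖D a - D x₀‖ + ‖D x₀‖ := by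
      simpa using norm_add_le (D a - D x₀) (D x₀)
    have : (κ : ℝ) * ‖a - x₀‖ ≤ κ * ρ := by gcongr
    linarith
  have hderiv : ∀ {a b : X}, a ∈ Metric.ball x₀ ρ → a + b ∈ Metric.ball x₀ ρ →
      ∀ s ∈ Set.Icc (0:ℝ) 1, HasDerivAt (fun s : ℝ => Ψ (a + s • b)) (D (a + s • b) b) s := by
    intro a b ha hab s hs
    have h1 : HasFDerivAt Ψ (D (a + s • b)) (a + s • b) :=
      (hball (hmem ha hab s hs)).2.hasFDerivAt
    have h2 : HasDerivAt (fun s : ℝ => a + s • b) b s := by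
      simpa using ((hasDerivAt_id s).smul_const b).const_add a
    exact h1.comp_hasDerivAt s h2
  have key := norm_image_sub_le_of_norm_deriv_le_segment_01'
    (f := fun s : ℝ => Ψ (x + s • e) - Ψ (y + s • f))
    (f' := fun s : ℝ => D (x + s • e) e - D (y + s • f) f)
    (C := (‖D x₀‖ + κ * ρ) * ‖e - f‖ + κ * (‖x - y‖ + ‖e - f‖) * ‖f‖)
    (fun s hs => ((hderiv hx hxe s hs).sub (hderiv hy hyf s hs)).hasDerivWithinAt)
    (fun s hs => by
      have hs' : s ∈ Set.Icc (0:ℝ) 1 := Set.Ico_subset_Icc_self hs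
      have e1 : D (x + s • e) e - D (y + s • f) f =
          D (x + s • e) (e - f) + (D (x + s • e) - D (y + s • f)) f := by
        simp
      rw [e1]
      refine (norm_add_le _ _).trans (add_le_add ?_ ?_)
      · refine (ContinuousLinearMap.le_opNorm _ _).trans ?_
        gcongr
        exact hDb _ (hmem hx hxe s hs')
      · refine (ContinuousLinearMap.le_opNorm _ _).trans ?_
        gcongr
        refine (hlip.norm_sub_le (hball (hmem hx hxe s hs')).1
          (hball (hmem hy hyf s hs')).1).trans ?_
        gcongr
        have : x + s • e - (y + s • f) = (x - y) + s • (e - f) := by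
          rw [smul_sub]; abel
        rw [this]
        refine (norm_add_le _ _).trans ?_
        rw [norm_smul, Real.norm_of_nonneg hs'.1]
        have := mul_le_mul_of_nonneg_right hs'.2 (norm_nonneg (e - f))
        linarith)
  simp only [one_smul, zero_smul, add_zero] at key
  have h0 := (le_abs_self _).trans key
  have h1 : κ * (‖x - y‖ + ‖e - f‖) * ‖f‖ ≤ κ * (‖f‖ * ‖x - y‖) + κ * (2 * ρ) * ‖e - f‖ := by
    have : (κ : ℝ) * ‖e - f‖ * ‖f‖ ≤ κ * ‖e - f‖ * (2 * ρ) := by gcongr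
    linarith
  have h2 : 0 ≤ (‖D x₀‖ + κ * ρ + κ * (2 * ρ) + 1) * (‖f‖ * ‖x - y‖) := by positivity
  have h3 : 0 ≤ ((κ : ℝ) + 1) * ‖e - f‖ := by positivity
  linarith

end SmoothRoots

/-! ### Smoothness of the second singular value of a matrix -/

section Matrices

open scoped Matrix.Norms.Elementwise

theorem contDiff_det_smul_one_sub {a b : Type*} [Fintype a] [Fintype b] [DecidableEq b] :
    ContDiff ℝ 2 fun q : Matrix a b ℝ × ℝ => (q.2 • (1 : Matrix b b ℝ) - q.1ᵀ * q.1).det := by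
  have hentry : ∀ i j, ContDiff ℝ 2 fun q : Matrix a b ℝ × ℝ => q.1 i j := fun i j =>
    (contDiff_pi.1 ((contDiff_pi.1 (contDiff_fst (E := Matrix a b ℝ) (F := ℝ))) i)) j
  simp only [Matrix.det_apply', Matrix.sub_apply, Matrix.smul_apply, Matrix.mul_apply,
    Matrix.transpose_apply, smul_eq_mul]
  refine ContDiff.sum fun σ _ => contDiff_const.mul (contDiff_prod fun i _ => ?_)
  refine (contDiff_snd.mul contDiff_const).sub (ContDiff.sum fun k _ => ?_)
  exact (hentry _ _).mul (hentry _ _)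

variable {a b : Type*} [Fintype a] [DecidableEq a] [Fintype b] [DecidableEq b]

theorem sigma_two (M : Matrix a b ℝ) : sigma M 2 = (Matrix.toEuclideanLin M).singularValues 1 :=
  rfl

theorem norm_toEuclideanLin_apply_le (M : Matrix a b ℝ) (v : EuclideanSpace ℝ b) :
    ‖Matrix.toEuclideanLin M v‖ ≤ Fintype.card a * Fintype.card b * ‖M‖ * ‖v‖ := by
  have h1 : ∀ w : EuclideanSpace ℝ a, ‖w‖ ≤ ∑ i, ‖w i‖ := fun w => by
    conv_lhs => rw [← (EuclideanSpace.basisFun a ℝ).sum_repr w]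
    refine (norm_sum_le _ _).trans (Finset.sum_le_sum fun i _ => ?_)
    rw [norm_smul]; simp
  refine (h1 _).trans ?_
  have h2 : ∀ i, ‖(Matrix.toEuclideanLin M v) i‖ ≤ Fintype.card b * ‖M‖ * ‖v‖ := fun i => by
    rw [Matrix.toLpLin_apply]
    change ‖∑ j, M i j * v j‖ ≤ _
    refine (norm_sum_le _ _).trans ?_
    calc ∑ j, ‖M i j * v j‖ ≤ ∑ _j : b, ‖M‖ * ‖v‖ := by
          refine Finset.sum_le_sum fun j _ => ?_
          rw [norm_mul]
          gcongr
          · exact M.norm_entry_le_entrywise_sup_norm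
          · exact PiLp.norm_apply_le v j
      _ = _ := by simp [mul_assoc]
  calc _ ≤ ∑ _i : a, Fintype.card b * ‖M‖ * ‖v‖ := Finset.sum_le_sum fun i _ => h2 i
    _ = _ := by simp [mul_assoc]

theorem exists_lipschitz_sigma_two :
    ∃ L > (0 : ℝ), ∀ M N : Matrix a b ℝ, |sigma M 2 - sigma N 2| ≤ L * ‖M - N‖ := by
  refine ⟨Fintype.card a * Fintype.card b + 1, by positivity, fun M N => ?_⟩
  rw [sigma_two, sigma_two]
  refine abs_singularValues_one_sub_le _ _ (by positivity) fun v => ?_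
  rw [← map_sub]
  refine (norm_toEuclideanLin_apply_le _ _).trans ?_
  gcongr
  linarith

theorem continuous_sigma_two : Continuous fun M : Matrix a b ℝ => sigma M 2 := by
  obtain ⟨L, hL, h⟩ := exists_lipschitz_sigma_two (a := a) (b := b)
  refine (LipschitzWith.of_dist_le_mul (K := L.toNNReal) fun M N => ?_).continuous
  rw [Real.dist_eq, dist_eq_norm, Real.coe_toNNReal _ hL.le]
  exact h M N

theorem charpoly_transpose_mul_self (M : Matrix a b ℝ) :
    (Mᵀ * M).charpoly = ∏ i : Fin (finrank ℝ (EuclideanSpace ℝ b)),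
      (Polynomial.X - Polynomial.C ((Matrix.toEuclideanLin M).singularValues i ^ 2)) := by
  set T := Matrix.toEuclideanLin M with hT
  have h1 : LinearMap.adjoint T ∘ₗ T = Matrix.toEuclideanLin (Mᵀ * M) := by
    rw [hT, ← Matrix.toEuclideanLin_conjTranspose_eq_adjoint, Matrix.conjTranspose_eq_transpose_of_trivial]
    ext v : 1
    simp [Matrix.toLpLin_apply]
  have h2 : (LinearMap.adjoint T ∘ₗ T).charpoly = (Mᵀ * M).charpoly := by
    rw [h1, Matrix.toEuclideanLin, Matrix.toLpLin_eq_toLin, Matrix.charpoly_toLin]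
  rw [← h2, T.isSymmetric_adjoint_comp_self.charpoly_eq rfl]
  refine Finset.prod_congr rfl fun i _ => ?_
  rw [T.sq_singularValues_fin rfl]; rfl

/-- The second singular value is `C²` at matrices where it is positive and simple. -/
theorem contDiffAt_sigma_two {M : Matrix a b ℝ} (hb : 1 < Fintype.card b)
    (hsimple : ∀ i : ℕ, i < Fintype.card b → i ≠ 1 →
      (Matrix.toEuclideanLin M).singularValues i ≠ sigma M 2) (hpos : 0 < sigma M 2) :
    ContDiffAt ℝ 2 (fun N : Matrix a b ℝ => sigma N 2) M := by
  have hcard : finrank ℝ (EuclideanSpace ℝ b) = Fintype.card b := by simp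
  let j : Fin (finrank ℝ (EuclideanSpace ℝ b)) := ⟨1, by omega⟩
  have heval : ∀ (N : Matrix a b ℝ) (t : ℝ), (t • (1 : Matrix b b ℝ) - Nᵀ * N).det =
      ∏ i : Fin (finrank ℝ (EuclideanSpace ℝ b)),
        (t - (Matrix.toEuclideanLin N).singularValues i ^ 2) := fun N t => by
    have h := Matrix.eval_charpoly (Nᵀ * N) t
    rw [charpoly_transpose_mul_self, Polynomial.eval_prod] at h
    simp only [Polynomial.eval_sub, Polynomial.eval_X, Polynomial.eval_C] at h
    rw [h, Matrix.smul_one_eq_diagonal]; rfl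
  -- σ₂² is a root of the characteristic polynomial of NᵀN, continuous in N by the Lipschitz bound.
  -- In the derivative of the factored polynomial at the root only the product omitting factor `j`
  -- survives, and simplicity makes it nonzero.
  have hsq : ContDiffAt ℝ 2 (fun N : Matrix a b ℝ => sigma N 2 ^ 2) M := by
    refine contDiffAt_of_simple_root contDiff_det_smul_one_sub
      (continuous_sigma_two.pow 2).continuousAt (fun N => ?_)
      (d := ∏ i ∈ Finset.univ.erase j,
        (sigma M 2 ^ 2 - (Matrix.toEuclideanLin M).singularValues i ^ 2)) ?_ ?_
    · dsimp only
      rw [heval]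
      exact Finset.prod_eq_zero (Finset.mem_univ j) (by rw [sigma_two]; simp [j])
    · simp only [heval]
      have h := HasDerivAt.fun_finsetProd (u := Finset.univ) (x := sigma M 2 ^ 2)
        (f := fun (i : Fin (finrank ℝ (EuclideanSpace ℝ b))) (t : ℝ) =>
          t - (Matrix.toEuclideanLin M).singularValues i ^ 2) (f' := fun _ => 1)
        (fun i _ => (hasDerivAt_id _).sub_const _)
      refine h.congr_deriv ?_
      rw [Finset.sum_eq_single j]
      · simp
      · intro i _ hi
        rw [Finset.prod_eq_zero (i := j) (by simp [Ne.symm hi]) (by rw [sigma_two]; simp [j])]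
        simp
      · simp
    · rw [Finset.prod_ne_zero_iff]
      intro i hi
      rw [Finset.mem_erase] at hi
      have h1 := hsimple i (by have := i.2; omega) (fun h => hi.1 (Fin.ext h))
      intro h2
      refine h1 ((pow_left_inj₀ (LinearMap.singularValues_nonneg _ _) hpos.le two_ne_zero).1 ?_)
      linarith
  have := hsq.sqrt (by positivity)
  refine this.congr_of_eventuallyEq (Eventually.of_forall fun N => ?_)
  exact (Real.sqrt_sq (LinearMap.singularValues_nonneg _ _)).symm

end Matrices

/-! ### Growth of a quadratic pencil along a kernel vector -/

section QuadraticForms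

/-- In the variable a' = εa the form is a'²(k + εα) + 2a'b(εm) + b²(q + εβ), a small perturbation of
k a'² + q b². -/
theorem add_mul_sq_le_of_small {k q : ℝ} (hk : 0 < k) (hq : 0 < q) (α β m : ℝ) :
    ∃ ε₀ > (0 : ℝ), ∀ ε : ℝ, |ε| < ε₀ → ∀ a b : ℝ,
      min k q / 4 * ε ^ 2 * (a ^ 2 + b ^ 2) ≤
        a ^ 2 * (ε ^ 2 * (k + ε * α)) + 2 * a * b * (ε ^ 2 * m) + b ^ 2 * (q + ε * β) := by
  have h1 : Tendsto (fun ε : ℝ => k + ε * α) (𝓝 0) (𝓝 k) := by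
    have : Continuous fun ε : ℝ => k + ε * α := by fun_prop
    simpa using this.tendsto 0
  have h2 : Tendsto (fun ε : ℝ => q + ε * β) (𝓝 0) (𝓝 q) := by
    have : Continuous fun ε : ℝ => q + ε * β := by fun_prop
    simpa using this.tendsto 0
  have h3 : Tendsto (fun ε : ℝ => ε ^ 2 * (4 * m ^ 2 / k)) (𝓝 0) (𝓝 0) := by
    have : Continuous fun ε : ℝ => ε ^ 2 * (4 * m ^ 2 / k) := by fun_prop
    simpa using this.tendsto 0
  have h4 : Tendsto (fun ε : ℝ => ε ^ 2) (𝓝 0) (𝓝 0) := by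
    have : Continuous fun ε : ℝ => ε ^ 2 := by fun_prop
    simpa using this.tendsto 0
  have hev := ((h1.eventually_const_lt (half_lt_self hk)).and
    (h2.eventually_const_lt (half_lt_self hq))).and
    ((h3.eventually_lt_const (by positivity : 0 < q / 4)).and (h4.eventually_lt_const one_pos))
  obtain ⟨ε₀, hε₀, hball⟩ := Metric.eventually_nhds_iff.1 hev
  refine ⟨ε₀, hε₀, fun ε hε a b => ?_⟩
  obtain ⟨⟨e1, e2⟩, e3, e4⟩ := hball (y := ε) (by simpa using hε)
  have f1 : a ^ 2 * (ε ^ 2 * (k / 2)) ≤ a ^ 2 * (ε ^ 2 * (k + ε * α)) := by gcongr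
  have f2 : b ^ 2 * (q / 2) ≤ b ^ 2 * (q + ε * β) := by gcongr
  have f3 : b ^ 2 * (ε ^ 2 * (4 * m ^ 2 / k)) ≤ b ^ 2 * (q / 4) := by gcongr
  have f4 : 0 ≤ ε ^ 2 * (a ^ 2 * (k / 4) + 2 * a * b * m + b ^ 2 * (4 * m ^ 2 / k)) := by
    have : a ^ 2 * (k / 4) + 2 * a * b * m + b ^ 2 * (4 * m ^ 2 / k) =
        k / 4 * (a + 4 * m * b / k) ^ 2 := by field_simp; ring
    rw [this]; positivity
  have f5 : ε ^ 2 * a ^ 2 * min k q ≤ ε ^ 2 * a ^ 2 * k := by gcongr; exact min_le_left _ _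
  have f6 : ε ^ 2 * (b ^ 2 * min k q) ≤ 1 * (b ^ 2 * q) := by
    gcongr
    exact min_le_right _ _
  nlinarith

/-- A cross term of order ε is dominated by diagonal terms of orders ε and 1, whose geometric mean
is of order √ε. -/
theorem mul_sq_le_of_small {ρ q : ℝ} (hρ : ρ ≠ 0) (hq : 0 < q) (β m : ℝ) :
    ∃ ε₀ > (0 : ℝ), ∀ ε : ℝ, |ε| < ε₀ → 0 < ε * ρ → ∀ a b : ℝ,
      ε * ρ / 2 * (a ^ 2 + b ^ 2) ≤
        a ^ 2 * (ε * ρ) + 2 * a * b * (ε * m) + b ^ 2 * (q + ε * β) := by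
  have h1 : Tendsto (fun ε : ℝ => q + ε * β - ε * ρ / 2 - 2 * ε * m ^ 2 / ρ) (𝓝 0) (𝓝 q) := by
    have : Continuous fun ε : ℝ => q + ε * β - ε * ρ / 2 - 2 * ε * m ^ 2 / ρ := by fun_prop
    simpa using this.tendsto 0
  obtain ⟨ε₀, hε₀, hball⟩ := Metric.eventually_nhds_iff.1 (h1.eventually_const_lt hq)
  refine ⟨ε₀, hε₀, fun ε hε hpos a b => ?_⟩
  have e1 := hball (y := ε) (by simpa using hε)
  have f1 : 0 ≤ b ^ 2 * (q + ε * β - ε * ρ / 2 - 2 * ε * m ^ 2 / ρ) := by positivity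
  have f2 : 0 ≤ ε * ρ * (a + 2 * m * b / ρ) ^ 2 := by positivity
  have f3 : ε * ρ * (a + 2 * m * b / ρ) ^ 2 =
      ε * ρ * a ^ 2 + 4 * (ε * m) * a * b + 4 * (ε * m ^ 2 / ρ) * b ^ 2 := by
    field_simp
    ring
  have f4 : 2 * ε * m ^ 2 / ρ = 2 * (ε * m ^ 2 / ρ) := by ring
  rw [f4] at f1
  rw [f3] at f2
  nlinarith

variable {E : Type*} [NormedAddCommGroup E] [InnerProductSpace ℝ E]

theorem linearIndependent_and_mul_norm_sq_le {x u : E} {κ R : ℝ} (hκ : 0 < κ) (hR : 0 < R)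
    (hxu : ‖x‖ ^ 2 + ‖u‖ ^ 2 ≤ R) {q : E → ℝ} (hq0 : q 0 = 0)
    (hq : ∀ a b : ℝ, κ * (a ^ 2 + b ^ 2) ≤ q (a • x + b • u)) :
    LinearIndependent ℝ ![x, u] ∧
      ∀ a b : ℝ, κ / R * ‖a • x + b • u‖ ^ 2 ≤ q (a • x + b • u) := by
  constructor
  · rw [LinearIndependent.pair_iff]
    intro a b hab
    have h := hq a b
    rw [hab, hq0] at h
    have h' : a ^ 2 + b ^ 2 ≤ 0 := by
      by_contra hc; push Not at hc; nlinarith [mul_pos hκ hc]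
    constructor <;> nlinarith [sq_nonneg a, sq_nonneg b]
  · intro a b
    refine le_trans ?_ (hq a b)
    have h1 : ‖a • x + b • u‖ ^ 2 ≤ (a ^ 2 + b ^ 2) * (‖x‖ ^ 2 + ‖u‖ ^ 2) := by
      have h := norm_add_le (a • x) (b • u)
      rw [norm_smul, norm_smul, Real.norm_eq_abs, Real.norm_eq_abs] at h
      have h2 : ‖a • x + b • u‖ ^ 2 ≤ (|a| * ‖x‖ + |b| * ‖u‖) ^ 2 := by gcongr
      have h3 : (|a| * ‖x‖ + |b| * ‖u‖) ^ 2 ≤ (|a| ^ 2 + |b| ^ 2) * (‖x‖ ^ 2 + ‖u‖ ^ 2) := by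
        nlinarith [sq_nonneg (|a| * ‖u‖ - |b| * ‖x‖)]
      rw [sq_abs, sq_abs] at h3
      exact h2.trans h3
    have h2 : ‖a • x + b • u‖ ^ 2 ≤ (a ^ 2 + b ^ 2) * R := h1.trans (by gcongr)
    calc κ / R * ‖a • x + b • u‖ ^ 2 ≤ κ / R * ((a ^ 2 + b ^ 2) * R) := by gcongr
      _ = _ := by field_simp

/-- The form `s ⟨Sx, x⟩ + ⟨SJx, Jx⟩`. -/
def pencil (S J : E →ₗ[ℝ] E) (s : ℝ) (x : E) : ℝ :=
  s * inner ℝ (S x) x + inner ℝ (S (J x)) (J x)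

/-- First order growth of the pencil along a kernel vector that is not isotropic for `S`. -/
theorem exists_pencil_linear_growth {S J : E →ₗ[ℝ] E} (hS : S.IsSymmetric)
    (hJ : ∀ x y, inner ℝ (J x) (J y) = inner ℝ x y) (hJJ : ∀ x, J (J x) = -x) {g : ℝ} {z u : E}
    (hz : g • S z = J (S (J z))) (hρ : inner ℝ (S z) z ≠ 0) (hu : 0 < pencil S J g u) :
    ∃ c > (0 : ℝ), ∃ ε₀ > (0 : ℝ), ∀ ε : ℝ, |ε| < ε₀ → 0 < ε * inner ℝ (S z) z →
      ∃ x w : E, LinearIndependent ℝ ![x, w] ∧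
        ∀ a b : ℝ, c * |ε| * ‖a • x + b • w‖ ^ 2 ≤ pencil S J (g + ε) (a • x + b • w) := by
  have hJs : ∀ x y, inner ℝ (J x) y = - inner ℝ x (J y) := fun x y => by
    rw [← hJ x (J y), hJJ, inner_neg_right, neg_neg]
  have hker : ∀ w, g * inner ℝ (S z) w + inner ℝ (S (J z)) (J w) = 0 := fun w => by
    have : inner ℝ (g • S z) w = inner ℝ (J (S (J z))) w := by rw [hz]
    rw [inner_smul_left, hJs] at this
    simp at this
    linarith
  -- On the plane of z and u the kernel equation removes all order zero terms involving z: what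
  -- remains is ε⟨Sz, z⟩ on the diagonal and ε⟨Sz, u⟩ off it.
  obtain ⟨ε₀, hε₀, h⟩ := mul_sq_le_of_small hρ hu (inner ℝ (S u) u) (inner ℝ (S z) u)
  have hR : 0 < ‖z‖ ^ 2 + ‖u‖ ^ 2 + 1 := by positivity
  refine ⟨|inner ℝ (S z) z| / 2 / (‖z‖ ^ 2 + ‖u‖ ^ 2 + 1), by positivity, ε₀, hε₀,
    fun ε hε hpos => ⟨z, u, ?_⟩⟩
  have key := linearIndependent_and_mul_norm_sq_le (x := z) (u := u)
    (q := pencil S J (g + ε)) (half_pos hpos) hR (by linarith) (by simp [pencil]) (fun a b => by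
      refine (h ε hε hpos a b).trans (le_of_eq ?_)
      have k1 := hker z
      have k2 := hker u
      have s1 : inner ℝ (S u) z = inner ℝ (S z) u := by rw [hS, real_inner_comm]
      have s2 : inner ℝ (S (J u)) (J z) = inner ℝ (S (J z)) (J u) := by rw [hS, real_inner_comm]
      simp only [pencil, map_add, map_smul, inner_add_left, inner_add_right, inner_smul_left,
        inner_smul_right, s1, s2, RCLike.conj_to_real]
      linear_combination (- a ^ 2) * k1 - 2 * a * b * k2)
  refine ⟨key.1, fun a b => le_trans (le_of_eq ?_) (key.2 a b)⟩
  have : |inner ℝ (S z) z| * |ε| = ε * inner ℝ (S z) z := by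
    rw [← abs_mul, mul_comm, abs_of_pos hpos]
  rw [← this]; ring

/-- Second order growth of the pencil along a kernel vector that is isotropic for `S`. -/
theorem exists_pencil_quadratic_growth {S J : E →ₗ[ℝ] E} (hS : S.IsSymmetric)
    (hJ : ∀ x y, inner ℝ (J x) (J y) = inner ℝ x y) (hJJ : ∀ x, J (J x) = -x) {g : ℝ}
    (hg : g ^ 2 < 1) {z : E} (hz : g • S z = J (S (J z))) (hρ : inner ℝ (S z) z = 0)
    (hp : S z ≠ 0) :
    ∃ c > (0 : ℝ), ∃ ε₀ > (0 : ℝ), ∀ ε : ℝ, |ε| < ε₀ → ε ≠ 0 →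
      ∃ x w : E, LinearIndependent ℝ ![x, w] ∧
        ∀ a b : ℝ, c * ε ^ 2 * ‖a • x + b • w‖ ^ 2 ≤ pencil S J (g + ε) (a • x + b • w) := by
  have hJs : ∀ x y, inner ℝ (J x) y = - inner ℝ x (J y) := fun x y => by
    rw [← hJ x (J y), hJJ, inner_neg_right, neg_neg]
  -- G represents the pencil at g, so that at g + ε the form is ⟨Gx, x⟩ + ε⟨Sx, x⟩, with Gz = 0 and
  -- ⟨Sz, z⟩ = 0.
  let G : E →ₗ[ℝ] E := g • S - J ∘ₗ S ∘ₗ J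
  have hGdef : ∀ x, G x = g • S x - J (S (J x)) := fun x => rfl
  have hGsymm : ∀ x y, inner ℝ (G x) y = inner ℝ (G y) x := fun x y => by
    rw [hGdef, hGdef, inner_sub_left, inner_sub_left, inner_smul_left, inner_smul_left, hJs, hJs,
      hS x y, hS (J x) (J y), real_inner_comm x (S y), real_inner_comm (J x) (S (J y))]
  have hpen : ∀ ε x, pencil S J (g + ε) x = inner ℝ (G x) x + ε * inner ℝ (S x) x := fun ε x => by
    rw [hGdef, inner_sub_left, inner_smul_left, hJs, pencil]
    simp; ring
  have hGz : G z = 0 := by rw [hGdef, hz, sub_self]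
  set p := S z with hpdef
  have hJz : S (J z) = -(g • J p) := by
    have := congrArg J hz
    rw [map_smul, hJJ] at this
    rw [this, neg_neg]
  -- The point where g² < 1 matters: Jz is isotropic for G without lying in its kernel, so a small
  -- push along Jp gives a direction on which G is positive.
  have hGJz : G (J z) = (1 - g ^ 2) • J p := by
    rw [hGdef, hJz, hJJ, map_neg, map_neg, ← hpdef]
    module
  have hg' : 0 < 1 - g ^ 2 := by linarith
  have hpp : 0 < inner ℝ p p := by
    rw [real_inner_self_eq_norm_sq]; exact pow_pos (norm_pos_iff.2 hp) 2
  have hJpp : inner ℝ (J p) p = 0 := by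
    have := hJs p p
    have h := real_inner_comm p (J p)
    linarith
  have hJpz : inner ℝ (J p) z = 0 := by
    have h1 := hGsymm (J z) z
    rw [hGJz, hGz, inner_smul_left] at h1
    simpa [hg'.ne'] using h1
  have hpJz : inner ℝ p (J z) = 0 := by have := hJs p z; linarith
  have hGJzJz : inner ℝ (G (J z)) (J z) = 0 := by
    rw [hGJz, inner_smul_left, hJ, hρ, mul_zero]
  set A := inner ℝ (G p) p with hA
  -- `c` is small enough that c|⟨Gp, p⟩| ≤ ⟨p, p⟩/2. This makes the second order coefficient of the
  -- corrected vector z + εcp positive and keeps the denominator of `κ` away from 0.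
  set c := inner ℝ p p / (2 * (|A| + 1)) with hc
  have hcpos : 0 < c := by positivity
  have hcA : c * |A| ≤ inner ℝ p p / 2 := by
    rw [hc, div_mul_eq_mul_div, div_le_div_iff₀ (by positivity) (by positivity)]
    nlinarith [abs_nonneg A]
  have hcA' : -(inner ℝ p p / 2) ≤ c * A := by
    have := mul_le_mul_of_nonneg_left (neg_abs_le A) hcpos.le
    linarith
  have hden : 0 < inner ℝ p p + c * A := by linarith
  set B := inner ℝ (G p) (J p) with hB
  -- `κ` is the solution of the linear equation saying that the order ε cross term ⟨p, u⟩ + ⟨Gy, u⟩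
  -- vanishes, for y = cp and u = Jz + δ(Jp + κp), whatever δ is.
  set κ := - (c * B) / (inner ℝ p p + c * A) with hκ
  set w := J p + κ • p with hw
  -- ⟨Gu, u⟩ equals δ times this quantity, whose limit as δ tends to 0 is 2(1 - g²)⟨p, p⟩ > 0.
  obtain ⟨δ, hδ0, hδ⟩ : ∃ δ > (0 : ℝ),
      0 < 2 * ((1 - g ^ 2) * inner ℝ p p) + δ * inner ℝ (G w) w := by
    have h1 : Tendsto (fun δ : ℝ => 2 * ((1 - g ^ 2) * inner ℝ p p) + δ * inner ℝ (G w) w)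
        (𝓝[>] 0) (𝓝 (2 * ((1 - g ^ 2) * inner ℝ p p))) := by
      have : Continuous fun δ : ℝ => 2 * ((1 - g ^ 2) * inner ℝ p p) + δ * inner ℝ (G w) w := by
        fun_prop
      simpa using (this.tendsto 0).mono_left nhdsWithin_le_nhds
    have h2 := (h1.eventually_const_lt (by positivity)).and self_mem_nhdsWithin
    obtain ⟨δ, h3, h4⟩ := h2.exists
    exact ⟨δ, h4, h3⟩
  set u := J z + δ • w with hu
  set y := c • p with hy
  have hGyy : inner ℝ (G y) y + 2 * inner ℝ p y = c * (c * A + 2 * inner ℝ p p) := by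
    rw [hy, map_smul, inner_smul_left, inner_smul_right, inner_smul_right]
    simp [← hA]; ring
  have hk : 0 < inner ℝ (G y) y + 2 * inner ℝ p y := by
    rw [hGyy]
    exact mul_pos hcpos (by linarith)
  have hGJzw : inner ℝ (G (J z)) w = (1 - g ^ 2) * inner ℝ p p := by
    rw [hGJz, hw, inner_smul_left, inner_add_right, inner_smul_right, hJ, hJpp]; simp
  have hGuu : inner ℝ (G u) u =
      δ * (2 * ((1 - g ^ 2) * inner ℝ p p) + δ * inner ℝ (G w) w) := by
    rw [hu, map_add, map_smul, inner_add_left, inner_add_right, inner_add_right, inner_smul_left,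
      inner_smul_right, inner_smul_left, inner_smul_right, hGJzJz, hGsymm w (J z), hGJzw]
    simp; ring
  have hq : 0 < inner ℝ (G u) u := by rw [hGuu]; positivity
  have hcross : inner ℝ p u + inner ℝ (G y) u = 0 := by
    have e1 : inner ℝ (G p) (J z) = 0 := by
      rw [hGsymm, hGJz, inner_smul_left, hJpp, mul_zero]
    have e2 : inner ℝ p (J p) = 0 := by rw [real_inner_comm]; exact hJpp
    have e3 : κ * (inner ℝ p p + c * A) = -(c * B) := by rw [hκ]; field_simp
    rw [hy, map_smul, inner_smul_left, hu, inner_add_right, inner_add_right, inner_smul_right,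
      inner_smul_right, hw, inner_add_right, inner_add_right, inner_smul_right, inner_smul_right,
      hpJz, e1, e2, ← hA, ← hB]
    rw [real_inner_self_eq_norm_sq] at e3 ⊢
    clear_value κ c A B
    simp only [RCLike.conj_to_real]
    linear_combination δ * e3
  obtain ⟨ε₀, hε₀, h⟩ := add_mul_sq_le_of_small hk hq (inner ℝ (S y) y) (inner ℝ (S u) u)
    (inner ℝ (S y) u)
  have hmin : 0 < min (inner ℝ (G y) y + 2 * inner ℝ p y) (inner ℝ (G u) u) := lt_min hk hq
  set μ := min (inner ℝ (G y) y + 2 * inner ℝ p y) (inner ℝ (G u) u)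
  have hR : 0 < (‖z‖ + ε₀ * ‖y‖) ^ 2 + ‖u‖ ^ 2 + 1 := by positivity
  refine ⟨μ / 4 / ((‖z‖ + ε₀ * ‖y‖) ^ 2 + ‖u‖ ^ 2 + 1), by positivity, ε₀, hε₀,
    fun ε hε hε0 => ⟨z + ε • y, u, ?_⟩⟩
  have hnorm : ‖z + ε • y‖ ≤ ‖z‖ + ε₀ * ‖y‖ := by
    refine (norm_add_le _ _).trans ?_
    rw [norm_smul, Real.norm_eq_abs]
    gcongr
  have key := linearIndependent_and_mul_norm_sq_le (x := z + ε • y) (u := u)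
    (q := pencil S J (g + ε)) (κ := μ / 4 * ε ^ 2) (by positivity) hR
    (by
      have : ‖z + ε • y‖ ^ 2 ≤ (‖z‖ + ε₀ * ‖y‖) ^ 2 := by gcongr
      linarith) (by simp [pencil]) (fun a b => by
      refine (h ε hε a b).trans (le_of_eq ?_)
      have s1 : inner ℝ (S u) z = inner ℝ p u := by rw [hS, real_inner_comm]
      have s2 : inner ℝ (S y) z = inner ℝ p y := by rw [hS, real_inner_comm]
      have s3 : inner ℝ (S u) y = inner ℝ (S y) u := by rw [hS, real_inner_comm]
      have s4 : inner ℝ (G u) y = inner ℝ (G y) u := hGsymm u y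
      have s5 : inner ℝ (G y) z = 0 := by rw [hGsymm, hGz, inner_zero_left]
      have s6 : inner ℝ (G u) z = 0 := by rw [hGsymm, hGz, inner_zero_left]
      rw [hpen]
      simp only [map_add, map_smul, inner_add_left, inner_add_right, inner_smul_left,
        inner_smul_right, s1, s2, s3, s4, s5, s6, hGz, inner_zero_left, RCLike.conj_to_real,
        ← hpdef, hρ]
      linear_combination (- 2 * a * b * ε) * hcross)
  refine ⟨key.1, fun a b => le_trans (le_of_eq ?_) (key.2 a b)⟩
  ring

end QuadraticForms

/-! ### Matrices acting on Euclidean space -/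

section MatrixAction

theorem toEuclideanLin_mul_apply {a b c : Type*} [Fintype b]
    [DecidableEq b] [Fintype c] [DecidableEq c] (A : Matrix a b ℝ) (B : Matrix b c ℝ)
    (x : EuclideanSpace ℝ c) :
    Matrix.toEuclideanLin (A * B) x = Matrix.toEuclideanLin A (Matrix.toEuclideanLin B x) := by
  simp [Matrix.toLpLin_apply]

variable {a b c : Type*} [Fintype a] [DecidableEq a] [Fintype b] [DecidableEq b] [Fintype c]
  [DecidableEq c]

theorem inner_toEuclideanLin (A : Matrix a b ℝ) (B : Matrix a c ℝ) (x : EuclideanSpace ℝ b)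
    (y : EuclideanSpace ℝ c) :
    inner ℝ (Matrix.toEuclideanLin A x) (Matrix.toEuclideanLin B y) =
      inner ℝ (Matrix.toEuclideanLin (Bᵀ * A) x) y := by
  rw [toEuclideanLin_mul_apply, ← Matrix.conjTranspose_eq_transpose_of_trivial B,
    Matrix.toEuclideanLin_conjTranspose_eq_adjoint, LinearMap.adjoint_inner_left]

end MatrixAction

/-! ### The block matrices as a pencil in the square of γ -/

section Blocks

variable {p m : ℕ}

/-- Multiplication by `i` on `ℂᵐ`, identified with `ℝᵐ ⊕ ℝᵐ`. -/
def rotation (m : ℕ) : Matrix (Fin m ⊕ Fin m) (Fin m ⊕ Fin m) ℝ := Matrix.fromBlocks 0 (-1) 1 0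

/-- The projection of `ℝᵐ ⊕ ℝᵐ` to its first summand. -/
def realProj (m : ℕ) : Matrix (Fin m ⊕ Fin m) (Fin m ⊕ Fin m) ℝ := Matrix.fromBlocks 1 0 0 0

/-- The scaling by `c` of the second summand of `ℝᵐ ⊕ ℝᵐ`. -/
def imagScale (m : ℕ) (c : ℝ) : Matrix (Fin m ⊕ Fin m) (Fin m ⊕ Fin m) ℝ :=
  Matrix.fromBlocks 1 0 0 (c • 1)

theorem rotation_mul_rotation : rotation m * rotation m = -1 := by
  rw [rotation, Matrix.fromBlocks_multiply, ← Matrix.fromBlocks_one, Matrix.fromBlocks_neg]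
  simp

theorem rotation_transpose_mul_rotation : (rotation m)ᵀ * rotation m = 1 := by
  rw [rotation, Matrix.fromBlocks_transpose, Matrix.fromBlocks_multiply, ← Matrix.fromBlocks_one]
  simp

theorem imagScale_mul_imagScale {c : ℝ} (hc : c ≠ 0) : imagScale m c * imagScale m c⁻¹ = 1 := by
  rw [imagScale, imagScale, Matrix.fromBlocks_multiply, ← Matrix.fromBlocks_one]
  simp [smul_smul, hc]

/-- At γ = 1 the block matrix is the realification of the complex matrix M, hence commutes with
multiplication by i. -/
theorem blockT_one_mul_rotation (M : Matrix (Fin p) (Fin m) ℂ) :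
    blockT M 1 * rotation m = rotation p * blockT M 1 := by
  rw [blockT, rotation, rotation, Matrix.fromBlocks_multiply, Matrix.fromBlocks_multiply]
  simp

theorem blockT_mul_imagScale (M : Matrix (Fin p) (Fin m) ℂ) {γ : ℝ} (hγ : γ ≠ 0) :
    blockT M γ * imagScale m γ⁻¹ = imagScale p γ⁻¹ * blockT M 1 := by
  rw [blockT, blockT, imagScale, imagScale, Matrix.fromBlocks_multiply,
    Matrix.fromBlocks_multiply]
  simp [smul_smul, hγ]

theorem imagScale_transpose_mul_self (c : ℝ) : (imagScale m c)ᵀ * imagScale m c =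
    realProj m + c ^ 2 • ((rotation m)ᵀ * realProj m * rotation m) := by
  rw [imagScale, rotation, realProj, Matrix.fromBlocks_transpose, Matrix.fromBlocks_transpose,
    Matrix.fromBlocks_multiply, Matrix.fromBlocks_multiply, Matrix.fromBlocks_multiply,
    Matrix.fromBlocks_smul, Matrix.fromBlocks_add]
  simp [smul_smul, sq]

/-- The symmetric matrix of `z ↦ |Re (M z)|² - σ² |Re z|²`. -/
def realForm (M : Matrix (Fin p) (Fin m) ℂ) (σ : ℝ) : Matrix (Fin m ⊕ Fin m) (Fin m ⊕ Fin m) ℝ :=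
  (blockT M 1)ᵀ * realProj p * blockT M 1 - σ ^ 2 • realProj m

theorem realProj_transpose : (realProj m)ᵀ = realProj m := by
  rw [realProj, Matrix.fromBlocks_transpose]; simp

theorem realForm_transpose (M : Matrix (Fin p) (Fin m) ℂ) (σ : ℝ) :
    (realForm M σ)ᵀ = realForm M σ := by
  rw [realForm, Matrix.transpose_sub, Matrix.transpose_smul, Matrix.transpose_mul,
    Matrix.transpose_mul, Matrix.transpose_transpose, realProj_transpose, realProj_transpose,
    Matrix.mul_assoc]

theorem isSymmetric_realForm (M : Matrix (Fin p) (Fin m) ℂ) (σ : ℝ) :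
    (Matrix.toEuclideanLin (realForm M σ)).IsSymmetric := fun x y => by
  have h1 := inner_toEuclideanLin (realForm M σ) 1 x y
  have h2 := inner_toEuclideanLin 1 (realForm M σ) x y
  rw [realForm_transpose, Matrix.mul_one, ← one_mul (realForm M σ)] at h2
  simp only [Matrix.transpose_one, one_mul] at h1 h2
  have h3 : ∀ v : EuclideanSpace ℝ (Fin m ⊕ Fin m),
      Matrix.toEuclideanLin (1 : Matrix (Fin m ⊕ Fin m) (Fin m ⊕ Fin m) ℝ) v = v := by simp
  rw [h3] at h2
  exact h2.symm

theorem inner_rotation (x y : EuclideanSpace ℝ (Fin m ⊕ Fin m)) :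
    inner ℝ (Matrix.toEuclideanLin (rotation m) x) (Matrix.toEuclideanLin (rotation m) y) =
      inner ℝ x y := by
  rw [inner_toEuclideanLin, rotation_transpose_mul_rotation]; simp

theorem rotation_rotation_apply (x : EuclideanSpace ℝ (Fin m ⊕ Fin m)) :
    Matrix.toEuclideanLin (rotation m) (Matrix.toEuclideanLin (rotation m) x) = -x := by
  rw [← toEuclideanLin_mul_apply, rotation_mul_rotation]; simp

/-- Conjugating to γ = 1 leaves γ only in the Gram matrices of diag(1, γ⁻¹), which are affine in
γ⁻². Multiplication by γ² gives a pencil linear in γ², whose two coefficients are the same form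
conjugated by the rotation. -/
theorem sq_smul_gram_sub (M : Matrix (Fin p) (Fin m) ℂ) (σ : ℝ) {γ : ℝ} (hγ : γ ≠ 0) :
    γ ^ 2 • ((blockT M γ * imagScale m γ⁻¹)ᵀ * (blockT M γ * imagScale m γ⁻¹) -
        σ ^ 2 • ((imagScale m γ⁻¹)ᵀ * imagScale m γ⁻¹)) =
      γ ^ 2 • realForm M σ + (rotation m)ᵀ * realForm M σ * rotation m := by
  have h1 : (blockT M 1)ᵀ * (rotation p)ᵀ = (rotation m)ᵀ * (blockT M 1)ᵀ := by
    rw [← Matrix.transpose_mul, ← Matrix.transpose_mul, blockT_one_mul_rotation]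
  rw [blockT_mul_imagScale M hγ, Matrix.transpose_mul, Matrix.mul_assoc,
    ← Matrix.mul_assoc (imagScale p γ⁻¹)ᵀ, imagScale_transpose_mul_self,
    imagScale_transpose_mul_self, realForm]
  have h2 : (blockT M 1)ᵀ * ((rotation p)ᵀ * realProj p * rotation p * blockT M 1) =
      (rotation m)ᵀ * ((blockT M 1)ᵀ * realProj p * blockT M 1) * rotation m := by
    rw [Matrix.mul_assoc, Matrix.mul_assoc, ← blockT_one_mul_rotation, ← Matrix.mul_assoc, h1]
    simp only [Matrix.mul_assoc]
  rw [Matrix.add_mul, Matrix.smul_mul, Matrix.mul_add, Matrix.mul_smul, h2, Matrix.mul_sub,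
    Matrix.sub_mul, Matrix.mul_smul, Matrix.smul_mul, ← Matrix.mul_assoc]
  have h3 : γ ^ 2 * γ⁻¹ ^ 2 = 1 := by field_simp
  simp only [smul_sub, smul_add, smul_smul]
  rw [h3, show γ ^ 2 * (σ ^ 2 * γ⁻¹ ^ 2) = σ ^ 2 by rw [mul_left_comm, h3, mul_one], one_smul]
  abel

theorem sq_mul_inner_sub (M : Matrix (Fin p) (Fin m) ℂ) (σ : ℝ) {γ : ℝ} (hγ : γ ≠ 0)
    (z w : EuclideanSpace ℝ (Fin m ⊕ Fin m)) :
    γ ^ 2 * (inner ℝ (Matrix.toEuclideanLin (blockT M γ) (Matrix.toEuclideanLin (imagScale m γ⁻¹) z))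
        (Matrix.toEuclideanLin (blockT M γ) (Matrix.toEuclideanLin (imagScale m γ⁻¹) w)) -
      σ ^ 2 * inner ℝ (Matrix.toEuclideanLin (imagScale m γ⁻¹) z)
        (Matrix.toEuclideanLin (imagScale m γ⁻¹) w)) =
    γ ^ 2 * inner ℝ (Matrix.toEuclideanLin (realForm M σ) z) w +
      inner ℝ (Matrix.toEuclideanLin (realForm M σ) (Matrix.toEuclideanLin (rotation m) z))
        (Matrix.toEuclideanLin (rotation m) w) := by
  rw [← toEuclideanLin_mul_apply, ← toEuclideanLin_mul_apply, ← toEuclideanLin_mul_apply,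
    inner_toEuclideanLin, inner_toEuclideanLin, inner_toEuclideanLin, ← Matrix.mul_assoc]
  have h := congrArg (fun N => inner ℝ (Matrix.toEuclideanLin N z) w) (sq_smul_gram_sub M σ hγ)
  simp only [map_smul, map_sub, map_add, LinearMap.smul_apply, LinearMap.sub_apply,
    LinearMap.add_apply, inner_add_left, inner_sub_left, inner_smul_left, RCLike.conj_to_real] at h
  simpa only [Matrix.mul_assoc] using h

theorem norm_sq_imagScale (c : ℝ) (z : EuclideanSpace ℝ (Fin m ⊕ Fin m)) :
    ‖Matrix.toEuclideanLin (imagScale m c) z‖ ^ 2 =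
      ‖Matrix.toEuclideanLin (realProj m) z‖ ^ 2 +
      c ^ 2 * ‖Matrix.toEuclideanLin (realProj m) (Matrix.toEuclideanLin (rotation m) z)‖ ^ 2 := by
  have hp : realProj m = (realProj m)ᵀ * realProj m := by
    rw [realProj_transpose, realProj, Matrix.fromBlocks_multiply]; simp
  have h1 : (imagScale m c)ᵀ * imagScale m c = (realProj m)ᵀ * realProj m +
      c ^ 2 • ((realProj m * rotation m)ᵀ * (realProj m * rotation m)) := by
    rw [imagScale_transpose_mul_self, Matrix.transpose_mul, Matrix.mul_assoc (rotation m)ᵀ,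
      Matrix.mul_assoc (rotation m)ᵀ, ← Matrix.mul_assoc (realProj m)ᵀ, ← hp]
  rw [← toEuclideanLin_mul_apply, ← real_inner_self_eq_norm_sq, ← real_inner_self_eq_norm_sq,
    ← real_inner_self_eq_norm_sq, inner_toEuclideanLin, inner_toEuclideanLin,
    inner_toEuclideanLin, h1]
  simp [inner_add_left, inner_smul_left]

theorem imagScale_one_apply (z : EuclideanSpace ℝ (Fin m ⊕ Fin m)) :
    Matrix.toEuclideanLin (imagScale m 1) z = z := by
  rw [imagScale, one_smul, Matrix.fromBlocks_one]; simp

theorem sq_mul_norm_sq_imagScale_le {γ : ℝ} (hγ0 : 0 < γ) (hγ1 : γ ≤ 1)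
    (z : EuclideanSpace ℝ (Fin m ⊕ Fin m)) :
    γ ^ 2 * ‖Matrix.toEuclideanLin (imagScale m γ⁻¹) z‖ ^ 2 ≤ ‖z‖ ^ 2 := by
  conv_rhs => rw [← imagScale_one_apply z]
  have h : γ ^ 2 * γ⁻¹ ^ 2 = 1 ^ 2 := by rw [← mul_pow, mul_inv_cancel₀ hγ0.ne']
  rw [norm_sq_imagScale, norm_sq_imagScale, mul_add, ← mul_assoc _ (γ⁻¹ ^ 2), h]
  gcongr
  have : γ ^ 2 ≤ 1 := pow_le_one₀ hγ0.le hγ1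
  nlinarith [sq_nonneg ‖Matrix.toEuclideanLin (realProj m) z‖]

theorem norm_sq_le_norm_sq_imagScale {γ : ℝ} (hγ0 : 0 < γ) (hγ1 : γ ≤ 1)
    (z : EuclideanSpace ℝ (Fin m ⊕ Fin m)) :
    ‖z‖ ^ 2 ≤ ‖Matrix.toEuclideanLin (imagScale m γ⁻¹) z‖ ^ 2 := by
  conv_lhs => rw [← imagScale_one_apply z]
  rw [norm_sq_imagScale, norm_sq_imagScale]
  gcongr
  exact (one_le_inv₀ hγ0).2 hγ1

theorem imagScale_imagScale_apply {c : ℝ} (hc : c ≠ 0) (z : EuclideanSpace ℝ (Fin m ⊕ Fin m)) :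
    Matrix.toEuclideanLin (imagScale m c) (Matrix.toEuclideanLin (imagScale m c⁻¹) z) = z := by
  rw [← toEuclideanLin_mul_apply, imagScale_mul_imagScale hc]; simp

/-- A plane on which the scaled form of `blockT M γ` is large bounds `σ₂(blockT M γ)` below. -/
theorem le_sigma_two_sq {M : Matrix (Fin p) (Fin m) ℂ} {γ σ κ : ℝ} (hγ : γ ≠ 0)
    (hκ : 0 ≤ σ ^ 2 + κ) {x w : EuclideanSpace ℝ (Fin m ⊕ Fin m)}
    (hxw : LinearIndependent ℝ ![x, w])
    (h : ∀ a b : ℝ,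
      κ * ‖Matrix.toEuclideanLin (imagScale m γ⁻¹) (a • x + b • w)‖ ^ 2 ≤
        ‖Matrix.toEuclideanLin (blockT M γ)
          (Matrix.toEuclideanLin (imagScale m γ⁻¹) (a • x + b • w))‖ ^ 2 -
        σ ^ 2 * ‖Matrix.toEuclideanLin (imagScale m γ⁻¹) (a • x + b • w)‖ ^ 2) :
    σ ^ 2 + κ ≤ sigma (blockT M γ) 2 ^ 2 := by
  have hLI : LinearIndependent ℝ ![Matrix.toEuclideanLin (imagScale m γ⁻¹) x,
      Matrix.toEuclideanLin (imagScale m γ⁻¹) w] := by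
    rw [LinearIndependent.pair_iff] at hxw ⊢
    intro a b hab
    refine hxw a b ?_
    rw [← map_smul, ← map_smul, ← map_add] at hab
    rw [← imagScale_imagScale_apply hγ (a • x + b • w), hab, map_zero]
  have := le_singularValues_one (Matrix.toEuclideanLin (blockT M γ)) hLI
    (s := √(σ ^ 2 + κ)) (fun a b => by
      have hab := h a b
      rw [map_add, map_smul, map_smul] at hab
      refine le_of_sq_le_sq ?_ (norm_nonneg _)
      rw [mul_pow, Real.sq_sqrt hκ]
      linarith)
  calc σ ^ 2 + κ = √(σ ^ 2 + κ) ^ 2 := (Real.sq_sqrt hκ).symm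
    _ ≤ _ := by rw [sigma_two]; gcongr

/-- The factor γ² in the pencil is exactly what compensates the stretching by diag(1, γ⁻¹), so the
same constant `κ` passes from the pencil to σ₂². -/
theorem le_sigma_two_sq_of_pencil {M : Matrix (Fin p) (Fin m) ℂ} {γ σ κ : ℝ} (hγ0 : 0 < γ)
    (hγ1 : γ ≤ 1) (hκ : 0 ≤ κ) {x w : EuclideanSpace ℝ (Fin m ⊕ Fin m)}
    (hxw : LinearIndependent ℝ ![x, w])
    (h : ∀ a b : ℝ, κ * ‖a • x + b • w‖ ^ 2 ≤
      pencil (Matrix.toEuclideanLin (realForm M σ)) (Matrix.toEuclideanLin (rotation m)) (γ ^ 2)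
        (a • x + b • w)) :
    σ ^ 2 + κ ≤ sigma (blockT M γ) 2 ^ 2 := by
  refine le_sigma_two_sq hγ0.ne' (by positivity) hxw fun a b => ?_
  set z := a • x + b • w
  have h1 := sq_mul_inner_sub M σ hγ0.ne' z z
  have h2 := h a b
  rw [pencil, ← h1, real_inner_self_eq_norm_sq, real_inner_self_eq_norm_sq] at h2
  have h3 := mul_le_mul_of_nonneg_left (sq_mul_norm_sq_imagScale_le hγ0 hγ1 z) hκ
  have h4 := h3.trans h2
  rw [mul_left_comm] at h4
  exact le_of_mul_le_mul_left h4 (by positivity)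

theorem norm_sq_smul_add_rotation (a b : ℝ) (z : EuclideanSpace ℝ (Fin m ⊕ Fin m)) :
    ‖a • z + b • Matrix.toEuclideanLin (rotation m) z‖ ^ 2 = (a ^ 2 + b ^ 2) * ‖z‖ ^ 2 := by
  have h0 : inner ℝ z (Matrix.toEuclideanLin (rotation m) z) = 0 := by
    have h1 := inner_rotation z (Matrix.toEuclideanLin (rotation m) z)
    rw [rotation_rotation_apply, inner_neg_right, real_inner_comm] at h1
    linarith
  have h1 : ‖Matrix.toEuclideanLin (rotation m) z‖ ^ 2 = ‖z‖ ^ 2 := by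
    rw [← real_inner_self_eq_norm_sq, inner_rotation, real_inner_self_eq_norm_sq]
  rw [sq, norm_add_sq_eq_norm_sq_add_norm_sq_of_inner_eq_zero _ _
    (by rw [inner_smul_left, inner_smul_right, h0]; simp), ← sq, ← sq, norm_smul, norm_smul,
    mul_pow, mul_pow, h1]
  simp; ring

theorem linearIndependent_rotation {z : EuclideanSpace ℝ (Fin m ⊕ Fin m)} (hz : z ≠ 0) :
    LinearIndependent ℝ ![z, Matrix.toEuclideanLin (rotation m) z] := by
  rw [LinearIndependent.pair_iff]
  intro a b hab
  have h := norm_sq_smul_add_rotation a b z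
  rw [hab, norm_zero] at h
  have hz' : 0 < ‖z‖ ^ 2 := pow_pos (norm_pos_iff.2 hz) 2
  have h' : a ^ 2 + b ^ 2 = 0 := by
    rcases mul_eq_zero.1 (h.symm.trans (by simp)) with h | h
    · exact h
    · exact absurd h hz'.ne'
  constructor <;> nlinarith [sq_nonneg a, sq_nonneg b]

theorem blockT_one_apply_smul_add_rotation (M : Matrix (Fin p) (Fin m) ℂ) (a b : ℝ)
    (z : EuclideanSpace ℝ (Fin m ⊕ Fin m)) :
    Matrix.toEuclideanLin (blockT M 1) (a • z + b • Matrix.toEuclideanLin (rotation m) z) =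
      a • Matrix.toEuclideanLin (blockT M 1) z +
        b • Matrix.toEuclideanLin (rotation p) (Matrix.toEuclideanLin (blockT M 1) z) := by
  rw [map_add, map_smul, map_smul, ← toEuclideanLin_mul_apply, blockT_one_mul_rotation,
    toEuclideanLin_mul_apply]

end Blocks

/-! ### Consequences of simplicity of the second singular value -/

section Growth

variable {p m : ℕ} {M : Matrix (Fin p) (Fin m) ℂ} {γ : ℝ}

theorem one_lt_card_of_isSimple (h : IsSimpleSingularValue (blockT M γ) 2) :
    1 < Fintype.card (Fin m ⊕ Fin m) := by
  have := (Finset.mem_Icc.1 h.1).2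
  rw [le_min_iff] at this
  omega

theorem singularValues_zero_ne_of_isSimple (h : IsSimpleSingularValue (blockT M γ) 2) :
    (Matrix.toEuclideanLin (blockT M γ)).singularValues 0 ≠ sigma (blockT M γ) 2 := by
  have h1 := (Finset.mem_Icc.1 h.1).2
  exact h.2 1 (Finset.mem_Icc.2 ⟨le_rfl, by omega⟩) (by norm_num)

theorem sigma_two_lt_of_isSimple (h : IsSimpleSingularValue (blockT M γ) 2) :
    sigma (blockT M γ) 2 < (Matrix.toEuclideanLin (blockT M γ)).singularValues 0 :=
  lt_of_le_of_ne (LinearMap.singularValues_antitone _ zero_le_one)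
    (singularValues_zero_ne_of_isSimple h).symm

/-- If the realification of M does not kill z, it is a nonzero multiple of an isometry on the real
plane spanned by z and iz, which bounds σ₂ below after scaling. If it is zero, then σ₁ = σ₂ = 0,
against simplicity. -/
theorem sigma_two_pos_of_isSimple (hγ0 : 0 < γ) (hγ1 : γ ≤ 1)
    (h : IsSimpleSingularValue (blockT M γ) 2) : 0 < sigma (blockT M γ) 2 := by
  by_cases hM : blockT M 1 = 0
  · exfalso
    have h1 : blockT M γ = 0 := by
      have h2 := blockT_mul_imagScale M hγ0.ne'
      have h3 : imagScale m γ⁻¹ * imagScale m γ = 1 := by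
        simpa using imagScale_mul_imagScale (m := m) (inv_ne_zero hγ0.ne')
      rw [← Matrix.mul_one (blockT M γ), ← h3, ← Matrix.mul_assoc, h2, hM, Matrix.mul_zero,
        Matrix.zero_mul]
    have h4 := singularValues_zero_ne_of_isSimple h
    rw [sigma_two, h1] at h4
    simp at h4
  · obtain ⟨z, hz⟩ : ∃ z, Matrix.toEuclideanLin (blockT M 1) z ≠ 0 := by
      by_contra hc
      push Not at hc
      exact hM (Matrix.toEuclideanLin.injective (by ext1 z; rw [hc]; simp))
    have hz0 : z ≠ 0 := by rintro rfl; simp at hz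
    set y := Matrix.toEuclideanLin (blockT M 1) z with hy
    have hzn : 0 < ‖z‖ ^ 2 := pow_pos (norm_pos_iff.2 hz0) 2
    have hyn : 0 < ‖y‖ ^ 2 := pow_pos (norm_pos_iff.2 hz) 2
    have key := le_sigma_two_sq (M := M) (σ := 0) (κ := ‖y‖ ^ 2 * γ ^ 2 / ‖z‖ ^ 2) hγ0.ne'
      (by positivity) (linearIndependent_rotation hz0) (fun a b => by
        have h1 := blockT_one_apply_smul_add_rotation M a b z
        have h2 := norm_sq_smul_add_rotation a b z
        have h3 := norm_sq_smul_add_rotation a b y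
        rw [← hy] at h1
        rw [← h1] at h3
        set x := a • z + b • Matrix.toEuclideanLin (rotation m) z
        rw [← toEuclideanLin_mul_apply (blockT M γ), blockT_mul_imagScale M hγ0.ne',
          toEuclideanLin_mul_apply]
        have h4 := norm_sq_le_norm_sq_imagScale hγ0 hγ1 (Matrix.toEuclideanLin (blockT M 1) x)
        have h5 := sq_mul_norm_sq_imagScale_le hγ0 hγ1 x
        rw [h3] at h4
        rw [h2] at h5
        have h6 : ‖y‖ ^ 2 * γ ^ 2 / ‖z‖ ^ 2 *
            ‖Matrix.toEuclideanLin (imagScale m γ⁻¹) x‖ ^ 2 ≤ (a ^ 2 + b ^ 2) * ‖y‖ ^ 2 := by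
          rw [div_mul_eq_mul_div, div_le_iff₀ hzn]
          have := mul_le_mul_of_nonneg_left h5 hyn.le
          linarith
        linarith)
    have h0 : 0 < sigma (blockT M γ) 2 ^ 2 := lt_of_lt_of_le (by positivity) key
    exact lt_of_le_of_ne (LinearMap.singularValues_nonneg _ _) (fun h => by
      rw [← h] at h0; simp at h0)

/-- At γ = 1 a top singular vector v and iv span a plane stretched by exactly σ₁, so σ₂ = σ₁ would
not be simple. -/
theorem lt_one_of_isSimple (hγ1 : γ ≤ 1) (h : IsSimpleSingularValue (blockT M γ) 2) : γ < 1 := by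
  refine lt_of_le_of_ne hγ1 ?_
  rintro rfl
  refine (sigma_two_lt_of_isSimple h).not_ge ?_
  have hcard : finrank ℝ (EuclideanSpace ℝ (Fin m ⊕ Fin m)) = Fintype.card (Fin m ⊕ Fin m) := by
    simp
  have hb := one_lt_card_of_isSimple h
  set T := Matrix.toEuclideanLin (blockT M 1) with hT
  set v := rightBasis T ⟨0, by omega⟩ with hv
  have hv1 : ‖v‖ = 1 := (rightBasis T).norm_eq_one _
  have hv0 : v ≠ 0 := by rw [← norm_pos_iff, hv1]; exact one_pos
  refine le_singularValues_one T (linearIndependent_rotation hv0) fun a b => ?_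
  refine le_of_sq_le_sq ?_ (norm_nonneg _)
  have h1 := blockT_one_apply_smul_add_rotation M a b v
  rw [← hT] at h1
  have h2 : ‖T v‖ = T.singularValues 0 := norm_apply_rightBasis T _
  rw [h1, norm_sq_smul_add_rotation, mul_pow, norm_sq_smul_add_rotation, h2, hv1]
  apply le_of_eq; ring

/-- Simplicity is stated only for indices up to the smaller dimension. Beyond it the singular values
are 0, and positivity of σ₂ separates them. -/
theorem singularValues_ne_of_isSimple (hγ0 : 0 < γ) (hγ1 : γ ≤ 1)
    (h : IsSimpleSingularValue (blockT M γ) 2) (i : ℕ) (hi : i ≠ 1) :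
    (Matrix.toEuclideanLin (blockT M γ)).singularValues i ≠ sigma (blockT M γ) 2 := by
  have hpos := sigma_two_pos_of_isSimple hγ0 hγ1 h
  by_cases h1 : i + 1 ≤ min (Fintype.card (Fin p ⊕ Fin p)) (Fintype.card (Fin m ⊕ Fin m))
  · exact h.2 (i + 1) (Finset.mem_Icc.2 ⟨by omega, h1⟩) (by omega)
  · have h2 : (Matrix.toEuclideanLin (blockT M γ)).singularValues i = 0 := by
      rw [LinearMap.singularValues_eq_zero_iff_le_finrank_range]
      have e1 := LinearMap.finrank_range_le (Matrix.toEuclideanLin (blockT M γ))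
      have e2 := Submodule.finrank_le (Matrix.toEuclideanLin (blockT M γ)).range
      rw [finrank_euclideanSpace] at e1 e2
      omega
    rw [h2]
    exact hpos.ne

open scoped Matrix.Norms.Elementwise in
theorem contDiffAt_blockT (M : Matrix (Fin p) (Fin m) ℂ) (hγ0 : γ ≠ 0) :
    ContDiffAt ℝ 2 (fun q : Matrix (Fin p) (Fin m) ℂ × ℝ => blockT q.1 q.2) (M, γ) := by
  have hentry : ∀ i j, ContDiffAt ℝ 2 (fun q : Matrix (Fin p) (Fin m) ℂ × ℝ => q.1 i j) (M, γ) :=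
    fun i j => ((contDiff_pi.1 ((contDiff_pi.1
      (contDiff_fst (E := Matrix (Fin p) (Fin m) ℂ) (F := ℝ))) i)) j).contDiffAt
  have hre : ∀ i j, ContDiffAt ℝ 2
      (fun q : Matrix (Fin p) (Fin m) ℂ × ℝ => (q.1 i j).re) (M, γ) :=
    fun i j => Complex.reCLM.contDiff.contDiffAt.comp (M, γ) (hentry i j)
  have him : ∀ i j, ContDiffAt ℝ 2
      (fun q : Matrix (Fin p) (Fin m) ℂ × ℝ => (q.1 i j).im) (M, γ) :=
    fun i j => Complex.imCLM.contDiff.contDiffAt.comp (M, γ) (hentry i j)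
  have hγ : ContDiffAt ℝ 2 (fun q : Matrix (Fin p) (Fin m) ℂ × ℝ => q.2) (M, γ) :=
    contDiff_snd.contDiffAt
  refine contDiffAt_pi.2 fun i => contDiffAt_pi.2 fun j => ?_
  rcases i with i | i <;> rcases j with j | j
  · exact hre i j
  · exact (hγ.mul (him i j)).neg
  · exact (hγ.inv hγ0).mul (him i j)
  · exact hre i j

open scoped Matrix.Norms.Elementwise in
theorem contDiffAt_sigma_two_blockT (hγ0 : 0 < γ) (hγ1 : γ ≤ 1)
    (h : IsSimpleSingularValue (blockT M γ) 2) :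
    ContDiffAt ℝ 2 (fun q : Matrix (Fin p) (Fin m) ℂ × ℝ => sigma (blockT q.1 q.2) 2) (M, γ) :=
  ContDiffAt.comp (M, γ) (g := fun N => sigma N 2)
    (f := fun q : Matrix (Fin p) (Fin m) ℂ × ℝ => blockT q.1 q.2)
    (contDiffAt_sigma_two (one_lt_card_of_isSimple h)
      (fun i _ hi => singularValues_ne_of_isSimple hγ0 hγ1 h i hi)
      (sigma_two_pos_of_isSimple hγ0 hγ1 h)) (contDiffAt_blockT M hγ0.ne')

open scoped Matrix.Norms.Elementwise in
theorem continuousOn_sigma_two_blockT (M : Matrix (Fin p) (Fin m) ℂ) {Γ : ℝ} (hΓ : 0 < Γ) :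
    ContinuousOn (fun γ => sigma (blockT M γ) 2) (Set.Icc Γ 1) := fun γ hγ => by
  have h1 := (contDiffAt_blockT M (hΓ.trans_le hγ.1).ne').continuousAt
  have h2 : ContinuousAt (fun γ : ℝ => (M, γ)) γ := by fun_prop
  exact ((continuous_sigma_two.continuousAt.comp
    (f := fun q : Matrix (Fin p) (Fin m) ℂ × ℝ => blockT q.1 q.2) h1).comp
    (f := fun γ : ℝ => (M, γ)) h2).continuousWithinAt

/-- A unit right singular vector for `σ₂`, rescaled, spans the kernel of the pencil. -/
theorem exists_kernel_vector (hγ0 : 0 < γ) (hγ1 : γ ≤ 1)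
    (h : IsSimpleSingularValue (blockT M γ) 2) :
    ∃ z, γ ^ 2 • Matrix.toEuclideanLin (realForm M (sigma (blockT M γ) 2)) z =
        Matrix.toEuclideanLin (rotation m)
          (Matrix.toEuclideanLin (realForm M (sigma (blockT M γ) 2))
            (Matrix.toEuclideanLin (rotation m) z)) ∧
      Matrix.toEuclideanLin (realForm M (sigma (blockT M γ) 2)) z ≠ 0 := by
  have hcard : finrank ℝ (EuclideanSpace ℝ (Fin m ⊕ Fin m)) = Fintype.card (Fin m ⊕ Fin m) := by
    simp
  have hb := one_lt_card_of_isSimple h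
  set σ := sigma (blockT M γ) 2 with hσ
  set T := Matrix.toEuclideanLin (blockT M γ) with hT
  set S := Matrix.toEuclideanLin (realForm M σ) with hS
  set J := Matrix.toEuclideanLin (rotation m) with hJ
  set D := Matrix.toEuclideanLin (imagScale m γ⁻¹) with hD
  set D' := Matrix.toEuclideanLin (imagScale m γ) with hD'
  have hDD' : ∀ x, D (D' x) = x := fun x => by
    have := imagScale_imagScale_apply (inv_ne_zero hγ0.ne') x
    rwa [inv_inv] at this
  have hD'D : ∀ x, D' (D x) = x := imagScale_imagScale_apply hγ0.ne'
  have hJJ : ∀ x, J (J x) = -x := rotation_rotation_apply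
  have hJi : ∀ x y, inner ℝ (J x) (J y) = inner ℝ x y := inner_rotation
  let j : Fin (finrank ℝ (EuclideanSpace ℝ (Fin m ⊕ Fin m))) := ⟨1, by omega⟩
  set v := rightBasis T j with hv
  have hv1 : ‖v‖ = 1 := (rightBasis T).norm_eq_one _
  have hTv : LinearMap.adjoint T (T v) = σ ^ 2 • v := adjoint_comp_rightBasis T j
  have hident := fun z w => sq_mul_inner_sub M σ hγ0.ne' z w
  rw [← hT, ← hS, ← hJ, ← hD] at hident
  have hker : ∀ w, γ ^ 2 * inner ℝ (S (D' v)) w + inner ℝ (S (J (D' v))) (J w) = 0 := fun w => by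
    rw [← hident, hDD', ← LinearMap.adjoint_inner_left, hTv, inner_smul_left]
    simp
  refine ⟨D' v, ?_, ?_⟩
  · refine ext_inner_right ℝ fun w => ?_
    have h1 := hJi (J (S (J (D' v)))) w
    rw [hJJ, inner_neg_left] at h1
    rw [inner_smul_left, ← h1]
    simp only [RCLike.conj_to_real]
    linarith [hker w]
  -- If Sz = 0, the kernel equation gives SJz = 0 as well. Then Jz also comes from a singular vector
  -- for σ₂ and is proportional to z by simplicity, which is impossible because z and Jz are
  -- independent.
  · intro h0
    have h1 : S (J (D' v)) = 0 := by
      refine ext_inner_right ℝ fun w => ?_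
      have h2 := hker (J w)
      rw [h0, hJJ] at h2
      simpa using h2
    set x := D (J (D' v)) with hx
    have hTx : LinearMap.adjoint T (T x) = σ ^ 2 • x := by
      refine ext_inner_right ℝ fun w => ?_
      have h2 := hident (J (D' v)) (D' w)
      rw [h1, hJJ, map_neg, h0, hDD'] at h2
      simp only [inner_zero_left, neg_zero, mul_zero, add_zero, mul_eq_zero] at h2
      rcases h2 with h2 | h2
      · exact absurd h2 (by positivity)
      · rw [LinearMap.adjoint_inner_left, inner_smul_left]
        simp only [RCLike.conj_to_real]
        linarith
    have h3 := eq_smul_rightBasis_of_adjoint_comp T (j := j)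
      (fun i hi => singularValues_ne_of_isSimple hγ0 hγ1 h i (fun hc => hi (Fin.ext hc))) hTx
    rw [← hv] at h3
    set c := inner ℝ v x
    have hz0 : D' v ≠ 0 := by
      intro hc
      have : v = 0 := by rw [← hDD' v, hc, map_zero]
      rw [this, norm_zero] at hv1
      exact zero_ne_one hv1
    have h4 : J (D' v) = c • D' v := by
      rw [← hD'D (J (D' v)), ← hx, h3, map_smul]
    have hLI := linearIndependent_rotation hz0
    rw [LinearIndependent.pair_iff] at hLI
    have h5 := hLI (-c) 1 (by rw [← hJ, h4, one_smul, neg_smul, neg_add_cancel])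
    exact one_ne_zero h5.2

/-- The top right singular vector, rescaled by diag(1, γ), works because σ₁ > σ₂. -/
theorem exists_pencil_pos (hγ0 : 0 < γ) (h : IsSimpleSingularValue (blockT M γ) 2) :
    ∃ u, 0 < pencil (Matrix.toEuclideanLin (realForm M (sigma (blockT M γ) 2)))
      (Matrix.toEuclideanLin (rotation m)) (γ ^ 2) u := by
  have hcard : finrank ℝ (EuclideanSpace ℝ (Fin m ⊕ Fin m)) = Fintype.card (Fin m ⊕ Fin m) := by
    simp
  have hb := one_lt_card_of_isSimple h
  have hlt := sigma_two_lt_of_isSimple h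
  set T := Matrix.toEuclideanLin (blockT M γ) with hT
  set v := rightBasis T ⟨0, by omega⟩ with hv
  have hv1 : ‖v‖ = 1 := (rightBasis T).norm_eq_one _
  have h2 : ‖T v‖ = T.singularValues 0 := norm_apply_rightBasis T _
  refine ⟨Matrix.toEuclideanLin (imagScale m γ) v, ?_⟩
  have h3 := imagScale_imagScale_apply (inv_ne_zero hγ0.ne') v
  rw [inv_inv] at h3
  rw [pencil, ← sq_mul_inner_sub M _ hγ0.ne', h3, ← hT, real_inner_self_eq_norm_sq,
    real_inner_self_eq_norm_sq, h2, hv1]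
  have h0 : 0 ≤ sigma (blockT M γ) 2 := LinearMap.singularValues_nonneg _ _
  have : sigma (blockT M γ) 2 ^ 2 < T.singularValues 0 ^ 2 := by gcongr
  have h4 : 0 < T.singularValues 0 ^ 2 - sigma (blockT M γ) 2 ^ 2 * 1 ^ 2 := by linarith
  positivity

end Growth

/-! ### Nondegeneracy of the minimizer in γ -/

section QuadraticGrowth

variable {p m : ℕ} {M : Matrix (Fin p) (Fin m) ℂ} {Γ γs : ℝ}

open scoped Matrix.Norms.Elementwise in
theorem differentiableAt_sigma_two_blockT (hγ0 : 0 < γs) (hγ1 : γs ≤ 1)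
    (h : IsSimpleSingularValue (blockT M γs) 2) :
    DifferentiableAt ℝ (fun γ => sigma (blockT M γ) 2) γs := by
  have h1 := (contDiffAt_sigma_two_blockT hγ0 hγ1 h).differentiableAt (by norm_num)
  have h2 : DifferentiableAt ℝ (fun γ : ℝ => (M, γ)) γs :=
    (differentiableAt_const _).prodMk differentiableAt_id
  exact h1.comp γs h2

/-- If `γ ↦ σ₂(blockT M γ)` is stationary, then it grows quadratically, whatever the sign of the
increment. -/
theorem eventually_quadratic_growth_of_stationary (hγ0 : 0 < γs) (hγ1 : γs ≤ 1)
    (h : IsSimpleSingularValue (blockT M γs) 2)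
    (hd : HasDerivAt (fun γ => sigma (blockT M γ) 2) 0 γs) :
    ∃ α > (0 : ℝ), ∀ᶠ γ in 𝓝 γs,
      α * (γ - γs) ^ 2 ≤ sigma (blockT M γ) 2 - sigma (blockT M γs) 2 := by
  have hlt1 := lt_one_of_isSimple hγ1 h
  have hpos := sigma_two_pos_of_isSimple hγ0 hγ1 h
  obtain ⟨z, hz, hp⟩ := exists_kernel_vector hγ0 hγ1 h
  obtain ⟨u, hu⟩ := exists_pencil_pos hγ0 h
  set σ := sigma (blockT M γs) 2 with hσ
  have hγev : ∀ᶠ γ in 𝓝 γs, 0 < γ ∧ γ < 1 :=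
    (eventually_gt_nhds hγ0).and (eventually_lt_nhds hlt1)
  have hεev : ∀ ε₀ > (0 : ℝ), ∀ᶠ γ in 𝓝 γs, |γ ^ 2 - γs ^ 2| < ε₀ := fun ε₀ hε₀ => by
    have h1 : Tendsto (fun γ : ℝ => |γ ^ 2 - γs ^ 2|) (𝓝 γs) (𝓝 0) := by
      have : Continuous fun γ : ℝ => |γ ^ 2 - γs ^ 2| := by fun_prop
      simpa using this.tendsto γs
    exact h1.eventually_lt_const hε₀
  have habs : ∀ γ : ℝ, 0 < γ → γs * |γ - γs| ≤ |γ ^ 2 - γs ^ 2| := fun γ hγ => by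
    rw [show γ ^ 2 - γs ^ 2 = (γ + γs) * (γ - γs) by ring, abs_mul,
      abs_of_pos (show 0 < γ + γs by linarith)]
    gcongr
    linarith
  -- Otherwise σ₂² would grow at least linearly on one side of `γs`, against its vanishing
  -- derivative.
  have hρ : inner ℝ (Matrix.toEuclideanLin (realForm M σ) z) z = 0 := by
    by_contra hρ
    obtain ⟨c, hc, ε₀, hε₀, hgrow⟩ := exists_pencil_linear_growth (isSymmetric_realForm M σ)
      inner_rotation rotation_rotation_apply hz hρ hu
    set ρ := inner ℝ (Matrix.toEuclideanLin (realForm M σ) z) z with hρdef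
    have hd2 : HasDerivAt (fun γ => sigma (blockT M γ) 2 ^ 2) 0 γs := by
      simpa using hd.fun_pow 2
    rw [hasDerivAt_iff_isLittleO] at hd2
    have hsmall := hd2.def (c := c * γs / 2) (by positivity)
    have hall := (hγev.and (hεev ε₀ hε₀)).and hsmall
    -- Moving in the direction of the sign of `ρ` makes (γ² - γs²)ρ positive, the side on which the
    -- linear growth holds.
    have htend : Tendsto (fun t : ℝ => γs + t * ρ) (𝓝[>] 0) (𝓝 γs) := by
      have : Continuous fun t : ℝ => γs + t * ρ := by fun_prop
      simpa using (this.tendsto 0).mono_left nhdsWithin_le_nhds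
    obtain ⟨t, ⟨⟨⟨g0, g1⟩, gε⟩, gs⟩, ht⟩ := ((htend.eventually hall).and self_mem_nhdsWithin).exists
    have ht' : (0 : ℝ) < t := ht
    set γ := γs + t * ρ with hγ
    have hγsub : γ - γs = t * ρ := by rw [hγ]; ring
    have hsign : 0 < (γ ^ 2 - γs ^ 2) * ρ := by
      have : (γ ^ 2 - γs ^ 2) * ρ = (γ + γs) * t * ρ ^ 2 := by
        rw [show γ ^ 2 - γs ^ 2 = (γ + γs) * (γ - γs) by ring, hγsub]; ring
      rw [this]; positivity
    obtain ⟨x, w, hxw, hform⟩ := hgrow (γ ^ 2 - γs ^ 2) gε hsign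
    rw [add_sub_cancel] at hform
    have hlow := le_sigma_two_sq_of_pencil g0 g1.le (by positivity) hxw hform
    simp only [smul_zero, sub_zero, Real.norm_eq_abs] at gs
    have h1 := (le_abs_self _).trans gs
    have h2 := mul_le_mul_of_nonneg_left (habs γ g0) hc.le
    have h3 : 0 < |γ - γs| := by rw [hγsub]; exact abs_pos.2 (mul_ne_zero ht'.ne' hρ)
    rw [← hσ] at h1
    have h4 : 0 < c * γs * |γ - γs| := by positivity
    linarith
  obtain ⟨c, hc, ε₀, hε₀, hgrow⟩ := exists_pencil_quadratic_growth (isSymmetric_realForm M σ)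
    inner_rotation rotation_rotation_apply
    (pow_lt_one₀ (sq_nonneg γs) (pow_lt_one₀ hγ0.le hlt1 two_ne_zero) two_ne_zero) hz hρ hp
  have hcont : ∀ᶠ γ in 𝓝 γs, sigma (blockT M γ) 2 < 2 * σ :=
    hd.continuousAt.tendsto.eventually_lt_const (by linarith)
  -- The pencil controls τ² - σ² = (τ - σ)(τ + σ), with τ the value at γ, and τ < 2σ near `γs`
  -- bounds the second factor by 3σ.
  refine ⟨c * γs ^ 2 / (3 * σ), by positivity, ?_⟩
  filter_upwards [hγev, hεev ε₀ hε₀, hcont] with γ ⟨g0, g1⟩ gε gc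
  by_cases hne : γ = γs
  · rw [hne, ← hσ]; simp
  have hε : γ ^ 2 - γs ^ 2 ≠ 0 := by
    rw [show γ ^ 2 - γs ^ 2 = (γ + γs) * (γ - γs) by ring]
    exact mul_ne_zero (by positivity) (sub_ne_zero.2 hne)
  obtain ⟨x, w, hxw, hform⟩ := hgrow _ gε hε
  rw [add_sub_cancel] at hform
  have hlow := le_sigma_two_sq_of_pencil g0 g1.le (by positivity) hxw hform
  have h1 : γs ^ 2 * (γ - γs) ^ 2 ≤ (γ ^ 2 - γs ^ 2) ^ 2 := by
    have := pow_le_pow_left₀ (by positivity) (habs γ g0) 2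
    rwa [mul_pow, sq_abs, sq_abs] at this
  set τ := sigma (blockT M γ) 2
  have h2 : c * (γs ^ 2 * (γ - γs) ^ 2) ≤ τ ^ 2 - σ ^ 2 := by
    have := mul_le_mul_of_nonneg_left h1 hc.le
    linarith
  have hτ0 : 0 ≤ τ := LinearMap.singularValues_nonneg _ _
  have h3 : 0 ≤ τ - σ := by
    have : 0 ≤ c * (γs ^ 2 * (γ - γs) ^ 2) := by positivity
    by_contra hc'
    push Not at hc'
    nlinarith
  rw [div_mul_eq_mul_div, div_le_iff₀ (by positivity)]
  nlinarith [mul_le_mul_of_nonneg_left gc.le h3]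

/-- With zero slope the pencil argument applies. With nonzero slope the minimizer must be the left
endpoint, because simplicity excludes γ = 1, and one-sided linear growth is more than enough. -/
theorem eventually_quadratic_growth (hΓ : 0 < Γ) (hγs : γs ∈ Set.Icc Γ 1)
    (hmin : ∀ γ ∈ Set.Icc Γ 1, γ ≠ γs →
      sigma (blockT M γs) 2 < sigma (blockT M γ) 2)
    (h : IsSimpleSingularValue (blockT M γs) 2) :
    ∃ α > (0 : ℝ), ∀ᶠ γ in 𝓝 γs, γ ∈ Set.Icc Γ 1 →
      α * (γ - γs) ^ 2 ≤ sigma (blockT M γ) 2 - sigma (blockT M γs) 2 := by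
  have hγ0 : 0 < γs := hΓ.trans_le hγs.1
  have hlt1 := lt_one_of_isSimple hγs.2 h
  have hd := (differentiableAt_sigma_two_blockT hγ0 hγs.2 h).hasDerivAt
  set d := deriv (fun γ => sigma (blockT M γ) 2) γs with hddef
  by_cases hd0 : d = 0
  · rw [hd0] at hd
    obtain ⟨α, hα, hev⟩ := eventually_quadratic_growth_of_stationary hγ0 hγs.2 h hd
    exact ⟨α, hα, hev.mono fun γ hγ _ => hγ⟩
  have hmin' : ∀ γ ∈ Set.Icc Γ 1, sigma (blockT M γs) 2 ≤ sigma (blockT M γ) 2 := fun γ hγ => by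
    by_cases hne : γ = γs
    · rw [hne]
    · exact (hmin γ hγ hne).le
  have hΓγs : γs = Γ := by
    by_contra hne
    refine hd0 (IsLocalMin.deriv_eq_zero ?_)
    have hlt : Γ < γs := lt_of_le_of_ne hγs.1 (Ne.symm hne)
    filter_upwards [Icc_mem_nhds hlt hlt1] with γ hγ using hmin' γ hγ
  rw [hasDerivAt_iff_isLittleO] at hd
  have hsmall := hd.def (c := |d| / 2) (by positivity)
  have hdpos : 0 < d := by
    by_contra hneg
    have hneg' : d < 0 := lt_of_le_of_ne (not_lt.1 hneg) hd0
    have hev : ∀ᶠ γ in 𝓝[>] γs, γ < 1 :=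
      (eventually_lt_nhds hlt1).filter_mono nhdsWithin_le_nhds
    obtain ⟨γ, ⟨h1, h2⟩, h3⟩ :=
      (((hsmall.filter_mono nhdsWithin_le_nhds).and hev).and self_mem_nhdsWithin).exists
    have h3' : 0 < γ - γs := sub_pos.2 h3
    have h4 := hmin' γ ⟨by linarith [hγs.1], h2.le⟩
    rw [Real.norm_eq_abs, Real.norm_eq_abs, abs_of_pos h3', abs_of_neg hneg', smul_eq_mul] at h1
    have h5 := (le_abs_self _).trans h1
    nlinarith [mul_pos h3' (neg_pos.2 hneg')]
  refine ⟨d / 2, by positivity, ?_⟩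
  filter_upwards [hsmall, eventually_lt_nhds (show γs < γs + 1 by linarith)] with γ h1 h2 hγ
  have h3 : 0 ≤ γ - γs := by rw [hΓγs]; linarith [hγ.1]
  rw [Real.norm_eq_abs, Real.norm_eq_abs, abs_of_nonneg h3, abs_of_pos hdpos, smul_eq_mul] at h1
  have h5 := (neg_le_abs _).trans h1
  have h6 : (γ - γs) ^ 2 ≤ γ - γs := by nlinarith
  nlinarith

/-- A unique minimiser of `γ ↦ σ₂(blockT M γ)` at which `σ₂` is simple is nondegenerate. -/
theorem exists_quadratic_growth (hΓ : 0 < Γ) (hγs : γs ∈ Set.Icc Γ 1)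
    (hmin : ∀ γ ∈ Set.Icc Γ 1, γ ≠ γs →
      sigma (blockT M γs) 2 < sigma (blockT M γ) 2)
    (h : IsSimpleSingularValue (blockT M γs) 2) :
    ∃ α > (0 : ℝ), ∀ γ ∈ Set.Icc Γ 1,
      α * (γ - γs) ^ 2 ≤ sigma (blockT M γ) 2 - sigma (blockT M γs) 2 := by
  obtain ⟨α, hα, hev⟩ := eventually_quadratic_growth hΓ hγs hmin h
  obtain ⟨η, hη, hball⟩ := Metric.eventually_nhds_iff.1 hev
  set K := Set.Icc Γ 1 \ Metric.ball γs η with hK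
  have hKc : IsCompact K := isCompact_Icc.diff Metric.isOpen_ball
  have hf : ContinuousOn (fun γ => sigma (blockT M γ) 2 - sigma (blockT M γs) 2) K :=
    ((continuousOn_sigma_two_blockT M hΓ).mono Set.sdiff_subset).sub continuousOn_const
  have hKpos : ∀ γ ∈ K, 0 < sigma (blockT M γ) 2 - sigma (blockT M γs) 2 := fun γ hγ => by
    refine sub_pos.2 (hmin γ hγ.1 ?_)
    rintro rfl
    exact hγ.2 (Metric.mem_ball_self hη)
  obtain ⟨ν, hν, hνK⟩ : ∃ ν > (0 : ℝ), ∀ γ ∈ K,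
      ν ≤ sigma (blockT M γ) 2 - sigma (blockT M γs) 2 := by
    by_cases hne : K.Nonempty
    · obtain ⟨γ₀, hγ₀, hle⟩ := hKc.exists_isMinOn hne hf
      exact ⟨_, hKpos γ₀ hγ₀, fun γ hγ => hle hγ⟩
    · exact ⟨1, one_pos, fun γ hγ => absurd ⟨γ, hγ⟩ hne⟩
  -- Away from `γs` compactness and uniqueness give the gap `ν`, and (γ - γs)² ≤ 1 on the interval.
  refine ⟨min α ν, lt_min hα hν, fun γ hγ => ?_⟩
  by_cases hγb : γ ∈ Metric.ball γs η
  · refine le_trans ?_ (hball hγb hγ)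
    gcongr
    exact min_le_left _ _
  · refine le_trans ?_ (hνK γ ⟨hγ, hγb⟩)
    have h1 : (γ - γs) ^ 2 ≤ 1 := by
      have := hγ.1; have := hγ.2; have := hγs.1; have := hγs.2
      rw [sq_le_one_iff_abs_le_one, abs_le]
      constructor <;> linarith
    calc min α ν * (γ - γs) ^ 2 ≤ ν * 1 := by
          gcongr
          exact min_le_right _ _
      _ = ν := mul_one ν

end QuadraticGrowth

/-! ### Hermite interpolation by the reduced transfer function -/

section Transfer

open scoped Matrix.Norms.L2Operator

variable {n m p r : ℕ}

theorem l2_opNorm_one_le (n : ℕ) : ‖(1 : Matrix (Fin n) (Fin n) ℂ)‖ ≤ 1 := by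
  have h := Matrix.l2_opNorm_conjTranspose_mul_self (1 : Matrix (Fin n) (Fin n) ℂ)
  rw [Matrix.conjTranspose_one, one_mul] at h
  nlinarith [norm_nonneg (1 : Matrix (Fin n) (Fin n) ℂ)]

theorem norm_entry_le_l2_opNorm (N : Matrix (Fin p) (Fin m) ℂ) (i : Fin p) (j : Fin m) :
    ‖N i j‖ ≤ ‖N‖ := by
  have h := Matrix.l2_opNorm_mulVec N (EuclideanSpace.single j 1)
  rw [PiLp.norm_single, norm_one, mul_one] at h
  refine le_trans ?_ h
  refine le_trans (le_of_eq ?_) (PiLp.norm_apply_le _ i)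
  simp

theorem l2_opNorm_le_one_of_orthonormal {V : Matrix (Fin n) (Fin r) ℂ} (hV : Vᴴ * V = 1) :
    ‖V‖ ≤ 1 := by
  have h := Matrix.l2_opNorm_conjTranspose_mul_self V
  rw [hV] at h
  have := l2_opNorm_one_le r
  nlinarith [norm_nonneg V]

theorem sigmaMin_mul_norm_le (X : Matrix (Fin r) (Fin r) ℂ) (v : EuclideanSpace ℂ (Fin r)) :
    sigmaMin X * ‖v‖ ≤ ‖Matrix.toEuclideanLin X v‖ := by
  have h := singularValues_last_mul_norm_le (Matrix.toEuclideanLin X) v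
  rwa [finrank_euclideanSpace] at h

theorem isUnit_and_norm_inv_le_of_le_sigmaMin {X : Matrix (Fin r) (Fin r) ℂ} {β : ℝ} (hβ : 0 < β)
    (h : β ≤ sigmaMin X) : IsUnit X ∧ ‖X⁻¹‖ ≤ β⁻¹ := by
  have hlow : ∀ v, β * ‖v‖ ≤ ‖Matrix.toEuclideanLin X v‖ := fun v =>
    (mul_le_mul_of_nonneg_right h (norm_nonneg v)).trans (sigmaMin_mul_norm_le X v)
  have hX : IsUnit X := by
    rw [← Matrix.mulVec_injective_iff_isUnit]
    intro x y hxy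
    have h1 := hlow (WithLp.toLp 2 (x - y))
    rw [Matrix.toLpLin_toLp, Matrix.toLin'_apply, Matrix.mulVec_sub, hxy, sub_self, WithLp.toLp_zero,
      norm_zero] at h1
    have h2 : ‖(WithLp.toLp 2 (x - y) : EuclideanSpace ℂ (Fin r))‖ = 0 :=
      le_antisymm (by nlinarith) (norm_nonneg _)
    rw [norm_eq_zero] at h2
    exact sub_eq_zero.1 (congrArg WithLp.ofLp h2)
  refine ⟨hX, ?_⟩
  rw [Matrix.l2_opNorm_def]
  refine ContinuousLinearMap.opNorm_le_bound _ (by positivity) fun v => ?_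
  change ‖Matrix.toEuclideanLin X⁻¹ v‖ ≤ _
  have h1 := hlow (Matrix.toEuclideanLin X⁻¹ v)
  have h2 : Matrix.toEuclideanLin X (Matrix.toEuclideanLin X⁻¹ v) = v := by
    have : X * X⁻¹ = 1 := Matrix.mul_nonsing_inv X ((Matrix.isUnit_iff_isUnit_det X).1 hX)
    simp [Matrix.toLpLin_apply, this]
  rw [h2] at h1
  rw [inv_mul_eq_div, le_div_iff₀' hβ]
  exact h1

theorem mul_inv_of_isUnit {X : Matrix (Fin r) (Fin r) ℂ} (hX : IsUnit X) : X * X⁻¹ = 1 :=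
  Matrix.mul_nonsing_inv X ((Matrix.isUnit_iff_isUnit_det X).1 hX)

theorem inv_mul_of_isUnit {X : Matrix (Fin r) (Fin r) ℂ} (hX : IsUnit X) : X⁻¹ * X = 1 :=
  Matrix.nonsing_inv_mul X ((Matrix.isUnit_iff_isUnit_det X).1 hX)

theorem shifted_eq_add (X : Matrix (Fin r) (Fin r) ℂ) (ω ω' : ℝ) :
    shifted X ω = shifted X ω' + (Complex.I * ((ω - ω' : ℝ) : ℂ)) • 1 := by
  rw [shifted, shifted, sub_add_eq_add_sub, ← add_smul]
  push_cast
  congr 2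
  ring

theorem inv_shifted_sub {X : Matrix (Fin r) (Fin r) ℂ} {ω ω' : ℝ} (h : IsUnit (shifted X ω))
    (h' : IsUnit (shifted X ω')) : (shifted X ω)⁻¹ - (shifted X ω')⁻¹ =
      -((Complex.I * ((ω - ω' : ℝ) : ℂ)) • ((shifted X ω)⁻¹ * (shifted X ω')⁻¹)) := by
  have h1 : (shifted X ω)⁻¹ * (shifted X ω' - shifted X ω) * (shifted X ω')⁻¹ =
      (shifted X ω)⁻¹ - (shifted X ω')⁻¹ := by
    rw [Matrix.mul_sub, Matrix.sub_mul, inv_mul_of_isUnit h, Matrix.mul_assoc,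
      mul_inv_of_isUnit h', Matrix.mul_one, Matrix.one_mul]
  rw [← h1, shifted_eq_add X ω ω', sub_add_cancel_left, Matrix.mul_neg, Matrix.neg_mul,
    Matrix.mul_smul, Matrix.smul_mul, Matrix.mul_one]

theorem norm_I_mul_ofReal (t : ℝ) : ‖Complex.I * (t : ℂ)‖ = |t| := by
  rw [norm_mul, Complex.norm_I, one_mul, Complex.norm_real, Real.norm_eq_abs]

theorem norm_inv_shifted_sub_le {X : Matrix (Fin r) (Fin r) ℂ} {ω ω' : ℝ}
    (h : IsUnit (shifted X ω)) (h' : IsUnit (shifted X ω')) :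
    ‖(shifted X ω)⁻¹ - (shifted X ω')⁻¹‖ ≤
      |ω - ω'| * (‖(shifted X ω)⁻¹‖ * ‖(shifted X ω')⁻¹‖) := by
  rw [inv_shifted_sub h h', norm_neg, norm_smul, norm_I_mul_ofReal]
  gcongr
  exact Matrix.l2_opNorm_mul _ _

/-- Invertibility at ω is given, so no Neumann series is needed: the resolvent identity yields ‖R‖ ≤
‖R‖/2 + κ. -/
theorem norm_inv_shifted_le {X : Matrix (Fin r) (Fin r) ℂ} {ω ω' κ : ℝ}
    (h : IsUnit (shifted X ω)) (h' : IsUnit (shifted X ω')) (hκ : ‖(shifted X ω')⁻¹‖ ≤ κ)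
    (hω : |ω - ω'| * κ ≤ 1 / 2) : ‖(shifted X ω)⁻¹‖ ≤ 2 * κ := by
  have h1 := norm_inv_shifted_sub_le h h'
  have h2 : ‖(shifted X ω)⁻¹‖ ≤ ‖(shifted X ω)⁻¹ - (shifted X ω')⁻¹‖ + ‖(shifted X ω')⁻¹‖ := by
    simpa using norm_add_le ((shifted X ω)⁻¹ - (shifted X ω')⁻¹) (shifted X ω')⁻¹
  have h3 : |ω - ω'| * (‖(shifted X ω)⁻¹‖ * ‖(shifted X ω')⁻¹‖) ≤ ‖(shifted X ω)⁻¹‖ * (1 / 2) := by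
    calc _ = ‖(shifted X ω)⁻¹‖ * (|ω - ω'| * ‖(shifted X ω')⁻¹‖) := by ring
      _ ≤ ‖(shifted X ω)⁻¹‖ * (1 / 2) := by
        gcongr
        exact (mul_le_mul_of_nonneg_left hκ (abs_nonneg _)).trans hω
  linarith

/-- The difference between the resolvent of `A` and the lifted resolvent of `A^V`. -/
def resolventGap (A : Matrix (Fin n) (Fin n) ℂ) (V : Matrix (Fin n) (Fin r) ℂ) (ω : ℝ) :
    Matrix (Fin n) (Fin n) ℂ :=
  (shifted A ω)⁻¹ - V * (shifted (projA A V) ω)⁻¹ * Vᴴ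

theorem shifted_projA {A : Matrix (Fin n) (Fin n) ℂ} {V : Matrix (Fin n) (Fin r) ℂ}
    (hV : Vᴴ * V = 1) (ω : ℝ) : shifted (projA A V) ω = Vᴴ * shifted A ω * V := by
  rw [shifted, shifted, projA, Matrix.mul_sub, Matrix.sub_mul, Matrix.mul_smul, Matrix.smul_mul,
    Matrix.mul_one, hV]

/-- Galerkin projection is exact when the solution already lies in the range of V. -/
theorem resolventGap_mul_shifted_mul {A : Matrix (Fin n) (Fin n) ℂ} {V : Matrix (Fin n) (Fin r) ℂ}
    (hV : Vᴴ * V = 1) {ω : ℝ} (h : IsUnit (shifted A ω)) (h' : IsUnit (shifted (projA A V) ω))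
    {N : Matrix (Fin n) (Fin m) ℂ} (hN : V * (Vᴴ * N) = N) :
    resolventGap A V ω * (shifted A ω * N) = 0 := by
  have h1 : (shifted (projA A V) ω)⁻¹ * (Vᴴ * (shifted A ω * (V * (Vᴴ * N)))) = Vᴴ * N := by
    calc _ = ((shifted (projA A V) ω)⁻¹ * (Vᴴ * shifted A ω * V)) * (Vᴴ * N) := by
          simp only [Matrix.mul_assoc]
      _ = Vᴴ * N := by rw [← shifted_projA hV, inv_mul_of_isUnit h', Matrix.one_mul]
  rw [hN] at h1
  rw [resolventGap, Matrix.sub_mul, ← Matrix.mul_assoc (shifted A ω)⁻¹, inv_mul_of_isUnit h,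
    Matrix.one_mul, Matrix.mul_assoc, Matrix.mul_assoc, h1, hN, sub_self]

/-- Hermite interpolation: the error of the reduced transfer function has a triple zero. -/
theorem reducedTransfer_sub_transfer {A : Matrix (Fin n) (Fin n) ℂ} {B : Matrix (Fin n) (Fin m) ℂ}
    {C : Matrix (Fin p) (Fin n) ℂ} {V : Matrix (Fin n) (Fin r) ℂ} (hV : Vᴴ * V = 1) {ω ω' : ℝ}
    (h : IsUnit (shifted A ω)) (h₀ : IsUnit (shifted A ω')) (h' : IsUnit (shifted (projA A V) ω))
    (hN : ∀ j ∈ Finset.Icc 1 3,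
      V * (Vᴴ * ((shifted A ω')⁻¹ ^ j * B)) = (shifted A ω')⁻¹ ^ j * B) :
    reducedTransfer A B C V ω - transfer A B C ω =
      (Complex.I * ((ω - ω' : ℝ) : ℂ)) ^ 3 •
        (C * resolventGap A V ω * ((shifted A ω')⁻¹ ^ 3 * B)) := by
  set s := Complex.I * ((ω - ω' : ℝ) : ℂ) with hs
  set R := (shifted A ω')⁻¹ with hR
  set Δ := resolventGap A V ω with hΔ
  -- With D(ω) = D(ω') + s the gap annihilates D(ω)RʲB = Rʲ⁻¹B + sRʲB. Each interpolated power thus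
  -- trades one factor R for one factor -s, and three powers give s³.
  have step : ∀ j ∈ Finset.Icc 1 3, Δ * (R ^ (j - 1) * B) = -(s • (Δ * (R ^ j * B))) := by
    intro j hj
    have hj1 := (Finset.mem_Icc.1 hj).1
    have h1 := resolventGap_mul_shifted_mul hV h h' (hN j hj)
    have h2 : shifted A ω * (R ^ j * B) = R ^ (j - 1) * B + s • (R ^ j * B) := by
      rw [shifted_eq_add A ω ω', Matrix.add_mul, Matrix.smul_mul, Matrix.one_mul]
      congr 1
      obtain ⟨i, rfl⟩ : ∃ i, j = i + 1 := ⟨j - 1, by omega⟩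
      rw [Nat.add_sub_cancel, pow_succ', ← Matrix.mul_assoc, ← Matrix.mul_assoc, hR,
        mul_inv_of_isUnit h₀, Matrix.one_mul]
    rw [h2, Matrix.mul_add, Matrix.mul_smul] at h1
    exact eq_neg_of_add_eq_zero_left h1
  have h3 : Δ * B = -(s ^ 3 • (Δ * (R ^ 3 * B))) := by
    have e1 := step 1 (by simp)
    have e2 := step 2 (by simp)
    have e3 := step 3 (by simp)
    simp only [Nat.sub_self, pow_zero, Matrix.one_mul] at e1
    norm_num at e2 e3
    rw [e1, pow_one, e2, e3]
    simp only [smul_neg, neg_neg, smul_smul]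
    congr 2
    ring
  have h4 : reducedTransfer A B C V ω - transfer A B C ω = -(C * (Δ * B)) := by
    rw [reducedTransfer, transfer, transfer, hΔ, resolventGap, Matrix.sub_mul, Matrix.mul_sub]
    simp only [Matrix.mul_assoc]
    abel
  rw [h4, h3, Matrix.mul_neg, neg_neg, Matrix.mul_smul, Matrix.mul_assoc]

theorem norm_pow_three_mul_sub_le {κ : ℝ} {R : Matrix (Fin n) (Fin n) ℂ} (hR : ‖R‖ ≤ κ)
    (B : Matrix (Fin n) (Fin m) ℂ) (C : Matrix (Fin p) (Fin n) ℂ) (Δ : Matrix (Fin n) (Fin n) ℂ) :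
    ‖C * Δ * (R ^ 3 * B)‖ ≤ ‖C‖ * κ ^ 3 * ‖B‖ * ‖Δ‖ := by
  have hκ : 0 ≤ κ := (norm_nonneg _).trans hR
  have h1 : ‖R ^ 3‖ ≤ κ ^ 3 := (norm_pow_le' R (by norm_num)).trans (by gcongr)
  calc ‖C * Δ * (R ^ 3 * B)‖ ≤ (‖C‖ * ‖Δ‖) * (κ ^ 3 * ‖B‖) := by
        refine (Matrix.l2_opNorm_mul _ _).trans ?_
        gcongr
        · exact Matrix.l2_opNorm_mul _ _
        · refine (Matrix.l2_opNorm_mul _ _).trans ?_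
          gcongr
    _ = _ := by ring

theorem norm_lift_le {V : Matrix (Fin n) (Fin r) ℂ} (hV : Vᴴ * V = 1)
    (X : Matrix (Fin r) (Fin r) ℂ) : ‖V * X * Vᴴ‖ ≤ ‖X‖ := by
  have h1 := l2_opNorm_le_one_of_orthonormal hV
  refine (Matrix.l2_opNorm_mul _ _).trans ?_
  rw [Matrix.l2_opNorm_conjTranspose]
  calc ‖V * X‖ * ‖V‖ ≤ (1 * ‖X‖) * 1 := by
        gcongr
        exact (Matrix.l2_opNorm_mul _ _).trans (by gcongr)
    _ = ‖X‖ := by ring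

theorem exists_lipschitz_transfer {A : Matrix (Fin n) (Fin n) ℂ} (hA : ∀ ω, IsUnit (shifted A ω))
    (B : Matrix (Fin n) (Fin m) ℂ) (C : Matrix (Fin p) (Fin n) ℂ) (ωs : ℝ) :
    ∃ K > (0 : ℝ), ∃ δ > (0 : ℝ), ∀ ω, |ω - ωs| < δ → ∀ i j,
      ‖(transfer A B C ω - transfer A B C ωs) i j‖ ≤ K * |ω - ωs| := by
  set κ := ‖(shifted A ωs)⁻¹‖ + 1 with hκ
  have hκ0 : 0 < κ := by positivity
  refine ⟨‖C‖ * (2 * κ * κ) * ‖B‖ + 1, by positivity, 1 / (2 * κ), by positivity,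
    fun ω hω i j => (norm_entry_le_l2_opNorm _ i j).trans ?_⟩
  have hω' : |ω - ωs| * κ ≤ 1 / 2 := by
    rw [lt_div_iff₀ (by positivity)] at hω; linarith
  have h1 := norm_inv_shifted_le (hA ω) (hA ωs) (by linarith : ‖(shifted A ωs)⁻¹‖ ≤ κ) hω'
  have h2 := norm_inv_shifted_sub_le (hA ω) (hA ωs)
  have h3 : transfer A B C ω - transfer A B C ωs =
      C * ((shifted A ω)⁻¹ - (shifted A ωs)⁻¹) * B := by
    rw [transfer, transfer, Matrix.mul_sub, Matrix.sub_mul]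
  rw [h3]
  calc ‖C * ((shifted A ω)⁻¹ - (shifted A ωs)⁻¹) * B‖
      ≤ (‖C‖ * ‖(shifted A ω)⁻¹ - (shifted A ωs)⁻¹‖) * ‖B‖ := by
        refine (Matrix.l2_opNorm_mul _ _).trans ?_
        gcongr
        exact Matrix.l2_opNorm_mul _ _
    _ ≤ (‖C‖ * (|ω - ωs| * (2 * κ * κ))) * ‖B‖ := by
        gcongr
        refine h2.trans ?_
        gcongr
        linarith
    _ ≤ _ := by nlinarith [abs_nonneg (ω - ωs)]

theorem abs_pow_three_sub_le {a b : ℂ} {h e : ℝ} (ha : ‖a‖ ≤ h + e) (hb : ‖b‖ ≤ h)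
    (hab : ‖a - b‖ ≤ e) : ‖a ^ 3 - b ^ 3‖ ≤ 3 * (h + e) ^ 2 * e := by
  have he : 0 ≤ e := (norm_nonneg _).trans hab
  have hh : 0 ≤ h := (norm_nonneg _).trans hb
  have hb' : ‖b‖ ≤ h + e := by linarith
  rw [show a ^ 3 - b ^ 3 = (a ^ 2 + a * b + b ^ 2) * (a - b) by ring, norm_mul]
  gcongr
  calc ‖a ^ 2 + a * b + b ^ 2‖ ≤ ‖a‖ ^ 2 + ‖a‖ * ‖b‖ + ‖b‖ ^ 2 := by
        refine (norm_add₃_le).trans ?_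
        rw [norm_pow, norm_mul, norm_pow]
    _ ≤ (h + e) ^ 2 + (h + e) * (h + e) + (h + e) ^ 2 := by gcongr
    _ = 3 * (h + e) ^ 2 := by ring

/-- Uniform bounds for the error of the reduced transfer function near `ωs`. -/
theorem exists_transfer_error_bounds {A : Matrix (Fin n) (Fin n) ℂ}
    (hA : ∀ ω, IsUnit (shifted A ω)) (B : Matrix (Fin n) (Fin m) ℂ) (C : Matrix (Fin p) (Fin n) ℂ)
    (ωs : ℝ) {β : ℝ} (hβ : 0 < β) :
    ∃ K > (0 : ℝ), ∃ δ > (0 : ℝ), ∀ (r : ℕ) (V : Matrix (Fin n) (Fin r) ℂ) (ω' ω : ℝ),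
      Vᴴ * V = 1 →
      (∀ j ∈ Finset.Icc 1 3, V * (Vᴴ * ((shifted A ω')⁻¹ ^ j * B)) = (shifted A ω')⁻¹ ^ j * B) →
      β ≤ sigmaMin (shifted (projA A V) ωs) → IsUnit (shifted (projA A V) ω) →
      |ω' - ωs| < δ → |ω - ωs| < δ →
      (∀ i j, ‖(reducedTransfer A B C V ωs - transfer A B C ωs) i j‖ ≤ K * |ω' - ωs| ^ 3) ∧
      ∀ i j, ‖((reducedTransfer A B C V ω - transfer A B C ω) -
          (reducedTransfer A B C V ωs - transfer A B C ωs)) i j‖ ≤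
        K * (|ω' - ωs| + |ω - ωs|) ^ 2 * |ω - ωs| + K * |ω' - ωs| ^ 3 * |ω - ωs| := by
  -- `κ` dominates the full and the reduced resolvent at `ωs`, the latter through `β`. Within 1/(2κ)
  -- of `ωs` both at most double, so every constant is independent of `r` and `V`.
  set κ := max ‖(shifted A ωs)⁻¹‖ β⁻¹ + 1 with hκ
  have hκ0 : 0 < κ := by positivity
  set Q := ‖C‖ * (2 * κ) ^ 3 * ‖B‖ with hQ
  have hQ0 : 0 ≤ Q := by positivity
  refine ⟨3 * (Q * (4 * κ)) + Q * (4 * κ ^ 2) + 1, by positivity, 1 / (2 * κ), by positivity, ?_⟩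
  intro r V ω' ω hV hN hσ hU hω' hω
  obtain ⟨hUs, hinv⟩ := isUnit_and_norm_inv_le_of_le_sigmaMin hβ hσ
  have hκ1 : ‖(shifted A ωs)⁻¹‖ ≤ κ := (le_max_left _ _).trans (by linarith)
  have hκ2 : ‖(shifted (projA A V) ωs)⁻¹‖ ≤ κ :=
    hinv.trans ((le_max_right _ _).trans (by linarith : max ‖(shifted A ωs)⁻¹‖ β⁻¹ ≤ κ))
  rw [lt_div_iff₀ (by positivity)] at hω hω'
  have hR' := norm_inv_shifted_le (hA ω') (hA ωs) hκ1 (by linarith)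
  have hR := norm_inv_shifted_le (hA ω) (hA ωs) hκ1 (by linarith)
  have hRV := norm_inv_shifted_le hU hUs hκ2 (by linarith)
  have hdR := norm_inv_shifted_sub_le (hA ω) (hA ωs)
  have hdRV := norm_inv_shifted_sub_le hU hUs
  have hgap : ∀ t, ‖(shifted A t)⁻¹‖ ≤ 2 * κ → ‖(shifted (projA A V) t)⁻¹‖ ≤ 2 * κ →
      ‖resolventGap A V t‖ ≤ 4 * κ := fun t h1 h2 => by
    rw [resolventGap]
    have := norm_lift_le hV (shifted (projA A V) t)⁻¹
    exact (norm_sub_le _ _).trans (by linarith)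
  have hgaps := hgap ωs (by linarith) (by linarith)
  have hgap1 := hgap ω hR hRV
  have hgapd : ‖resolventGap A V ω - resolventGap A V ωs‖ ≤ |ω - ωs| * (4 * κ ^ 2) := by
    have e1 : resolventGap A V ω - resolventGap A V ωs =
        ((shifted A ω)⁻¹ - (shifted A ωs)⁻¹) -
          V * ((shifted (projA A V) ω)⁻¹ - (shifted (projA A V) ωs)⁻¹) * Vᴴ := by
      rw [resolventGap, resolventGap, Matrix.mul_sub, Matrix.sub_mul]; abel
    rw [e1]
    refine (norm_sub_le _ _).trans ?_
    have e2 := (norm_lift_le hV _).trans hdRV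
    have e3 : |ω - ωs| * (‖(shifted A ω)⁻¹‖ * ‖(shifted A ωs)⁻¹‖) ≤
        |ω - ωs| * (2 * κ * κ) := by gcongr
    have e4 : |ω - ωs| * (‖(shifted (projA A V) ω)⁻¹‖ * ‖(shifted (projA A V) ωs)⁻¹‖) ≤
        |ω - ωs| * (2 * κ * κ) := by gcongr
    linarith
  rw [reducedTransfer_sub_transfer hV (hA ω) (hA ω') hU hN,
    reducedTransfer_sub_transfer hV (hA ωs) (hA ω') hUs hN]
  set a := Complex.I * ((ω - ω' : ℝ) : ℂ) with ha
  set b := Complex.I * ((ωs - ω' : ℝ) : ℂ) with hb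
  have hbn : ‖b‖ = |ω' - ωs| := by rw [hb, norm_I_mul_ofReal, abs_sub_comm]
  have han : ‖a‖ ≤ |ω' - ωs| + |ω - ωs| := by
    rw [ha, norm_I_mul_ofReal, show ω - ω' = (ω - ωs) - (ω' - ωs) by ring]
    exact (abs_sub _ _).trans (by linarith)
  have habn : ‖a - b‖ ≤ |ω - ωs| := by
    rw [ha, hb, ← mul_sub, ← Complex.ofReal_sub, norm_I_mul_ofReal]
    apply le_of_eq; congr 1; ring
  have hcube := abs_pow_three_sub_le han hbn.le habn
  set R := (shifted A ω')⁻¹ with hRdef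
  set h := |ω' - ωs| with hh
  set e := |ω - ωs| with he
  have hh0 : 0 ≤ h := abs_nonneg _
  have he0 : 0 ≤ e := abs_nonneg _
  constructor
  · intro i j
    refine (norm_entry_le_l2_opNorm _ i j).trans ?_
    rw [norm_smul, norm_pow, hbn]
    have h1 := (norm_pow_three_mul_sub_le hR' B C (resolventGap A V ωs)).trans
      (mul_le_mul_of_nonneg_left hgaps hQ0)
    calc h ^ 3 * ‖C * resolventGap A V ωs * (R ^ 3 * B)‖ ≤ h ^ 3 * (Q * (4 * κ)) := by gcongr
      _ ≤ _ := by
        have : 0 ≤ h ^ 3 * (2 * (Q * (4 * κ)) + Q * (4 * κ ^ 2) + 1) := by positivity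
        linarith
  · intro i j
    refine (norm_entry_le_l2_opNorm _ i j).trans ?_
    -- The change of the cubic factor contributes (h + e)² e, and the Lipschitz change of the gap
    -- contributes h³ e.
    have e1 : a ^ 3 • (C * resolventGap A V ω * (R ^ 3 * B)) -
        b ^ 3 • (C * resolventGap A V ωs * (R ^ 3 * B)) =
        (a ^ 3 - b ^ 3) • (C * resolventGap A V ω * (R ^ 3 * B)) +
        b ^ 3 • (C * (resolventGap A V ω - resolventGap A V ωs) * (R ^ 3 * B)) := by
      rw [Matrix.mul_sub, Matrix.sub_mul, sub_smul, smul_sub]; abel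
    rw [e1]
    refine (norm_add_le _ _).trans ?_
    rw [norm_smul, norm_smul, norm_pow b, hbn]
    have h1 := (norm_pow_three_mul_sub_le hR' B C (resolventGap A V ω)).trans
      (mul_le_mul_of_nonneg_left hgap1 hQ0)
    have h2 := (norm_pow_three_mul_sub_le hR' B C
      (resolventGap A V ω - resolventGap A V ωs)).trans
      (mul_le_mul_of_nonneg_left hgapd hQ0)
    have h3 : ‖a ^ 3 - b ^ 3‖ * ‖C * resolventGap A V ω * (R ^ 3 * B)‖ ≤
        3 * (h + e) ^ 2 * e * (Q * (4 * κ)) := by gcongr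
    have h4 : h ^ 3 * ‖C * (resolventGap A V ω - resolventGap A V ωs) * (R ^ 3 * B)‖ ≤
        h ^ 3 * (Q * (e * (4 * κ ^ 2))) := by gcongr
    have h5 : 0 ≤ (h + e) ^ 2 * e * (Q * (4 * κ ^ 2) + 1) := by positivity
    have h6 : 0 ≤ h ^ 3 * e * (3 * (Q * (4 * κ)) + 1) := by positivity
    linarith

theorem isUnit_shifted_of_isHurwitz {A : Matrix (Fin n) (Fin n) ℝ} (hA : IsHurwitz A) (ω : ℝ) :
    IsUnit (shifted (toC A) ω) := by
  by_contra h
  have hmem : Complex.I * (ω : ℂ) ∈ spectrum ℂ (toC A) := by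
    rw [spectrum.mem_iff, Algebra.algebraMap_eq_smul_one]
    exact h
  have := hA _ hmem
  simp at this

theorem mul_conjTranspose_mul_of_range_le {b : Type*} [Fintype b] [DecidableEq b]
    {V : Matrix (Fin n) (Fin r) ℂ} (hV : Vᴴ * V = 1) {N : Matrix (Fin n) b ℂ}
    (h : LinearMap.range N.mulVecLin ≤ LinearMap.range V.mulVecLin) : V * (Vᴴ * N) = N := by
  refine Matrix.ext_of_mulVec_single fun i => ?_
  obtain ⟨y, hy⟩ := h (LinearMap.mem_range_self N.mulVecLin (Pi.single i 1))
  simp only [Matrix.mulVecLin_apply] at hy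
  rw [← Matrix.mulVec_mulVec, ← Matrix.mulVec_mulVec, ← hy, Matrix.mulVec_mulVec _ Vᴴ, hV,
    Matrix.one_mulVec]

theorem range_mul_le {b c : Type*} [Fintype b] [Fintype c] (N : Matrix (Fin n) b ℂ)
    (X : Matrix b c ℂ) :
    LinearMap.range (N * X).mulVecLin ≤ LinearMap.range N.mulVecLin := by
  rintro _ ⟨x, rfl⟩
  exact ⟨X *ᵥ x, by simp⟩

theorem interpBlock_range_le {A : Matrix (Fin n) (Fin n) ℂ} {B : Matrix (Fin n) (Fin m) ℂ} {ω : ℝ}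
    {j : ℕ} (hj : j ∈ Finset.Icc 1 3) :
    LinearMap.range ((shifted A ω)⁻¹ ^ j * B).mulVecLin ≤
      LinearMap.range (interpBlock A B ω).mulVecLin := by
  obtain ⟨X, hX⟩ : ∃ X : Matrix (Fin m ⊕ (Fin m ⊕ Fin m)) (Fin m) ℂ,
      (shifted A ω)⁻¹ ^ j * B = interpBlock A B ω * X := by
    rw [Finset.mem_Icc] at hj
    obtain ⟨h1, h3⟩ := hj
    interval_cases j
    · refine ⟨Matrix.fromRows (1 : Matrix (Fin m) (Fin m) ℂ) 0, ?_⟩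
      rw [interpBlock, Matrix.fromCols_mul_fromRows]; simp
    · refine ⟨Matrix.fromRows 0 (Matrix.fromRows (1 : Matrix (Fin m) (Fin m) ℂ) 0), ?_⟩
      rw [interpBlock, Matrix.fromCols_mul_fromRows, Matrix.fromCols_mul_fromRows]; simp
    · refine ⟨Matrix.fromRows 0 (Matrix.fromRows 0 (1 : Matrix (Fin m) (Fin m) ℂ)), ?_⟩
      rw [interpBlock, Matrix.fromCols_mul_fromRows, Matrix.fromCols_mul_fromRows]; simp
  rw [hX]
  exact range_mul_le _ _

theorem range_right_le_fromCols {b c : Type*} [Fintype b] [Fintype c] [DecidableEq c]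
    (X : Matrix (Fin n) b ℂ) (Y : Matrix (Fin n) c ℂ) :
    LinearMap.range Y.mulVecLin ≤ LinearMap.range (Matrix.fromCols X Y).mulVecLin := by
  have : Y = Matrix.fromCols X Y * (Matrix.fromRows 0 (1 : Matrix c c ℂ) : Matrix (b ⊕ c) c ℂ) := by
    rw [Matrix.fromCols_mul_fromRows]; simp
  conv_lhs => rw [this]
  exact range_mul_le _ _

/-- Only the block added last matters: it comes from the initialization for k = 1 and from the
expansion at step k - 1 otherwise. -/
theorem IsSubspaceRun.orthonormal_and_interpolates {Γ : ℝ} {A : Matrix (Fin n) (Fin n) ℂ}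
    {B : Matrix (Fin n) (Fin m) ℂ} {C : Matrix (Fin p) (Fin n) ℂ} {N : ℕ} {r : ℕ → ℕ}
    {V : (k : ℕ) → Matrix (Fin n) (Fin (r k)) ℂ} {ω : ℕ → ℝ}
    (hrun : IsSubspaceRun Γ A B C N r V ω) {k : ℕ} (hk : 1 ≤ k) (hkN : k ≤ N) :
    (V k)ᴴ * V k = 1 ∧ ∀ j ∈ Finset.Icc 1 3,
      V k * ((V k)ᴴ * ((shifted A (ω k))⁻¹ ^ j * B)) = (shifted A (ω k))⁻¹ ^ j * B := by
  have key : (V k)ᴴ * V k = 1 ∧ LinearMap.range (interpBlock A B (ω k)).mulVecLin ≤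
      LinearMap.range (V k).mulVecLin := by
    rcases Nat.lt_or_ge 1 k with h1 | h1
    · obtain ⟨i, rfl⟩ : ∃ i, k = i + 1 := ⟨k - 1, by omega⟩
      have h := hrun.expand i (by omega) (by omega)
      exact ⟨h.1, h.2 ▸ range_right_le_fromCols _ _⟩
    · obtain rfl : k = 1 := le_antisymm h1 hk
      exact ⟨hrun.init.1, hrun.init.2.ge⟩
  exact ⟨key.1, fun j hj =>
    mul_conjTranspose_mul_of_range_le key.1 ((interpBlock_range_le hj).trans key.2)⟩

end Transfer

/-! ### Quadratic decay at the maximizer and the scalar rate -/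

section LocalMax

/-- A local maximum with nonzero second derivative is a quadratic one. -/
theorem exists_quadratic_decay {f : ℝ → ℝ} {x : ℝ} (hmax : IsLocalMax f x)
    (hcont : ContinuousAt f x) (h2 : iteratedDeriv 2 f x ≠ 0) :
    ∃ c > (0 : ℝ), ∀ᶠ y in 𝓝 x, c * (y - x) ^ 2 ≤ f x - f y := by
  have hd2 : iteratedDeriv 2 f x = deriv (deriv f) x := by
    rw [iteratedDeriv_succ, iteratedDeriv_one]
  rw [hd2] at h2
  have hg := (differentiableAt_of_deriv_ne_zero h2).hasDerivAt
  set d := deriv (deriv f) x with hd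
  have hg0 : deriv f x = 0 := hmax.deriv_eq_zero
  rw [hasDerivAt_iff_isLittleO] at hg
  have hsmall := hg.def (c := |d| / 2) (by positivity)
  obtain ⟨η, hη, hball⟩ := Metric.eventually_nhds_iff_ball.1 hsmall
  have hb : ∀ h t : ℝ, |h| < η → t ∈ Set.Ioc (0 : ℝ) 1 →
      |deriv f (x + t * h) - d * (t * h)| ≤ |d| / 2 * |t * h| := fun h t hh ht => by
    have hmem : x + t * h ∈ Metric.ball x η := by
      rw [mem_ball_iff_norm, add_sub_cancel_left, Real.norm_eq_abs, abs_mul, abs_of_pos ht.1]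
      nlinarith [abs_nonneg h, ht.2]
    have := hball _ hmem
    rw [hg0, add_sub_cancel_left, sub_zero, smul_eq_mul, mul_comm (t * h)] at this
    exact this
  -- No differentiability of f near x is assumed. The derivative has default value 0 where it does
  -- not exist, and it is nonzero near x off x itself, so f is differentiable there.
  have hdiff : ∀ h t : ℝ, h ≠ 0 → |h| < η → t ∈ Set.Ioc (0 : ℝ) 1 →
      DifferentiableAt ℝ f (x + t * h) := fun h t h0 hh ht => by
    refine differentiableAt_of_deriv_ne_zero fun hc => ?_
    have h1 := hb h t hh ht
    have h3 : 0 < |d| * |t * h| :=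
      mul_pos (abs_pos.2 h2) (abs_pos.2 (mul_ne_zero ht.1.ne' h0))
    rw [hc, zero_sub, abs_neg, abs_mul] at h1
    linarith
  -- Mean value theorem for t ↦ f(x + th) + q h² t² on [0, 1]; continuity at the endpoint t = 0
  -- comes from `hcont`. The parameter q replaces a Taylor expansion.
  have hslope : ∀ h : ℝ, h ≠ 0 → |h| < η → ∀ q : ℝ, ∃ t ∈ Set.Ioo (0 : ℝ) 1,
      f (x + h) + q * h ^ 2 - f x = deriv f (x + t * h) * h + 2 * q * t * h ^ 2 := by
    intro h h0 hh q
    obtain ⟨t, ht, heq⟩ := exists_hasDerivAt_eq_slope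
      (fun t => f (x + t * h) + q * h ^ 2 * t ^ 2)
      (fun t => deriv f (x + t * h) * h + q * h ^ 2 * (2 * t)) zero_lt_one
      (fun t ht => by
        have hlin : ContinuousAt (fun t : ℝ => x + t * h) t := by fun_prop
        have hf : ContinuousAt f (x + t * h) := by
          rcases eq_or_lt_of_le ht.1 with rfl | ht0
          · simpa using hcont
          · exact (hdiff h t h0 hh ⟨ht0, ht.2⟩).continuousAt
        exact ((ContinuousAt.comp (f := fun t : ℝ => x + t * h) hf hlin).add
          (by fun_prop)).continuousWithinAt)
      (fun t ht => by
        have h1 := (hdiff h t h0 hh ⟨ht.1, ht.2.le⟩).hasDerivAt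
        have h3 : HasDerivAt (fun t : ℝ => x + t * h) h t := by
          simpa using ((hasDerivAt_id t).mul_const h).const_add x
        have h4 : HasDerivAt (fun t : ℝ => q * h ^ 2 * t ^ 2) (q * h ^ 2 * (2 * t)) t := by
          simpa using (hasDerivAt_pow 2 t).const_mul (q * h ^ 2)
        exact (HasDerivAt.comp t h1 h3).add h4)
    refine ⟨t, ht, ?_⟩
    simp at heq
    linarith
  have hdneg : d < 0 := by
    by_contra hnn
    have hdpos : 0 < d := lt_of_le_of_ne (not_lt.1 hnn) (Ne.symm h2)
    have hmax' : ∀ᶠ h in 𝓝 (0 : ℝ), f (x + h) ≤ f x := by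
      have : Tendsto (fun h : ℝ => x + h) (𝓝 0) (𝓝 x) := by
        have : Continuous fun h : ℝ => x + h := by fun_prop
        simpa using this.tendsto 0
      exact this.eventually hmax
    obtain ⟨h, ⟨h1, h3⟩, h4⟩ := (((hmax'.filter_mono nhdsWithin_le_nhds).and
      ((eventually_lt_nhds hη).filter_mono nhdsWithin_le_nhds)).and
      (self_mem_nhdsWithin (s := Set.Ioi (0 : ℝ)))).exists
    have h4' : (0 : ℝ) < h := h4
    have hh : |h| < η := by rwa [abs_of_pos h4']
    obtain ⟨t, ht, heq⟩ := hslope h h4'.ne' hh 0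
    have h5 := hb h t hh ⟨ht.1, ht.2.le⟩
    have hth : 0 < t * h := mul_pos ht.1 h4'
    rw [abs_of_pos hdpos, abs_of_pos hth] at h5
    have h6 := (abs_le.1 h5).1
    have h7 : 0 < deriv f (x + t * h) := by nlinarith [mul_pos hdpos hth]
    have h8 : 0 < deriv f (x + t * h) * h := mul_pos h7 h4'
    linarith
  refine ⟨-d / 4, by linarith, ?_⟩
  filter_upwards [Metric.ball_mem_nhds x hη] with y hy
  by_cases hyx : y = x
  · simp [hyx]
  have h0 : y - x ≠ 0 := sub_ne_zero.2 hyx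
  have hh : |y - x| < η := by rwa [mem_ball_iff_norm, Real.norm_eq_abs] at hy
  -- With q = -d/4 the added term -(d/2) t (y - x)² and the error of the same size exactly cancel
  -- the main term d t (y - x)².
  obtain ⟨t, ht, heq⟩ := hslope (y - x) h0 hh (-d / 4)
  have h5 := hb (y - x) t hh ⟨ht.1, ht.2.le⟩
  rw [add_sub_cancel] at heq
  have h6 : (deriv f (x + t * (y - x)) - d * (t * (y - x))) * (y - x) ≤
      -d / 2 * t * (y - x) ^ 2 := by
    refine (le_abs_self _).trans ?_
    rw [abs_mul]
    calc _ ≤ |d| / 2 * |t * (y - x)| * |y - x| := by gcongr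
      _ = _ := by rw [abs_mul, abs_of_neg hdneg, abs_of_pos ht.1, ← sq_abs (y - x)]; ring
  nlinarith

/-- If e exceeded h², then h⁴ ≤ h²e, and dividing by e gives the bound. -/
theorem le_mul_sq_of_sq_le {μ W e h : ℝ} (hμ : 0 < μ) (hW : 0 ≤ W)
    (hyp : μ / 2 * e ^ 2 ≤ W * (h ^ 2 * e + h ^ 4)) : e ≤ (4 * W / μ + 1) * h ^ 2 := by
  by_contra hc
  push Not at hc
  have h1 : h ^ 2 ≤ (4 * W / μ + 1) * h ^ 2 := by
    have : 0 ≤ 4 * W / μ * h ^ 2 := by positivity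
    linarith
  have h2 : h ^ 4 ≤ h ^ 2 * e := by
    rw [show h ^ 4 = h ^ 2 * h ^ 2 by ring]
    gcongr
    linarith
  have h3 : μ / 2 * e ^ 2 ≤ W * (2 * (h ^ 2 * e)) :=
    hyp.trans (mul_le_mul_of_nonneg_left (by linarith) hW)
  have he0 : 0 < e := lt_of_le_of_lt (by positivity) hc
  have h4 : μ * e ≤ 4 * W * h ^ 2 := by
    have : e * (μ * e) ≤ e * (4 * W * h ^ 2) := by linarith
    exact le_of_mul_le_mul_left this he0
  have h5 : e ≤ 4 * W / μ * h ^ 2 := by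
    rw [div_mul_eq_mul_div, le_div_iff₀ hμ]; linarith
  have : 0 ≤ h ^ 2 := sq_nonneg h
  linarith

/-- Here `f`, `d`, `M` stand for ‖F‖, ‖E - F‖, ‖M₁ - M₀‖, and `t₀`, `t₁` for the displacements of
the minimizers in γ. -/
theorem exists_quadratic_rate {c K T l : ℝ} (hc : 0 < c) (hK : 0 < K) (hT : 0 < T) (hl : 0 < l) :
    ∃ c' > (0 : ℝ), ∃ δ > (0 : ℝ), ∀ h e f d M t₀ t₁ : ℝ, 0 ≤ h → h < δ → 0 ≤ e → e < δ →
      f ≤ T * h ^ 3 → d ≤ T * (h + e) ^ 2 * e + T * h ^ 3 * e → 0 ≤ M → M ≤ l * e →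
      t₀ ^ 2 ≤ K * f → t₁ ^ 2 ≤ K * M → c * e ^ 2 ≤ K * (d + f * (M + |t₀| + |t₁|)) →
      e ≤ c' * h ^ 2 := by
  set W := K * T * (5 + l + K * T + K * l) with hW
  have hW0 : 0 < W := by positivity
  -- The bound e ≤ c/(4KT) lets half of c e² absorb the cubic term 2KT e³.
  refine ⟨4 * W / c + 1, by positivity, min 1 (c / (4 * (K * T))), by positivity, ?_⟩
  intro h e f d M t₀ t₁ hh hhδ he heδ hf hd hM0 hM ht₀ ht₁ hyp
  refine le_mul_sq_of_sq_le hc hW0.le ?_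
  have hh1 : h ≤ 1 := (hhδ.trans_le (min_le_left _ _)).le
  have heδ' : e * (4 * (K * T)) ≤ c := by
    have := heδ.trans_le (min_le_right _ _)
    rw [lt_div_iff₀ (by positivity)] at this
    exact this.le
  -- Splitting h³|t| this way uses only t²: a t² of order h³ or of order e contributes O(h⁴) or
  -- O(h²e), so the square root loss in γ is harmless.
  have hcube : ∀ t : ℝ, h ^ 3 * |t| ≤ h ^ 4 + h ^ 2 * t ^ 2 := fun t => by
    have h1 : 0 ≤ h ^ 2 * (h ^ 2 - h * |t| + |t| ^ 2) := by
      have : 0 ≤ h ^ 2 - h * |t| + |t| ^ 2 := by nlinarith [sq_nonneg (h - |t|), abs_nonneg t]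
      positivity
    rw [sq_abs] at h1
    linarith
  have hh3 : h ^ 3 * e ≤ h ^ 2 * e := by
    have : h ^ 3 ≤ h ^ 2 := pow_le_pow_of_le_one hh hh1 (by norm_num)
    gcongr
  have b0 : h ^ 2 * t₀ ^ 2 ≤ K * T * h ^ 4 := by
    have h1 : t₀ ^ 2 ≤ K * (T * h ^ 3) := ht₀.trans (by gcongr)
    calc h ^ 2 * t₀ ^ 2 ≤ h ^ 2 * (K * (T * h ^ 3)) := by gcongr
      _ = K * T * h ^ 4 * h := by ring
      _ ≤ K * T * h ^ 4 * 1 := by gcongr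
      _ = _ := mul_one _
  have b1 : h ^ 2 * t₁ ^ 2 ≤ K * l * (h ^ 2 * e) := by
    have h1 : t₁ ^ 2 ≤ K * (l * e) := ht₁.trans (by gcongr)
    calc h ^ 2 * t₁ ^ 2 ≤ h ^ 2 * (K * (l * e)) := by gcongr
      _ = _ := by ring
  have b2 : f * (M + |t₀| + |t₁|) ≤ T * h ^ 3 * (l * e + |t₀| + |t₁|) := by gcongr
  have b3 : h ^ 3 * (l * e + |t₀| + |t₁|) ≤
      (2 + K * T) * h ^ 4 + (l + K * l) * (h ^ 2 * e) := by
    have h1 := hcube t₀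
    have h2 := hcube t₁
    have h3 := mul_le_mul_of_nonneg_left hh3 hl.le
    linarith
  have b4 : (h + e) ^ 2 * e ≤ 2 * (h ^ 2 * e) + 2 * e * e ^ 2 := by
    nlinarith [mul_nonneg he (sq_nonneg (h - e))]
  have b5 : d + f * (M + |t₀| + |t₁|) ≤
      T * ((3 + l + K * l) * (h ^ 2 * e) + (2 + K * T) * h ^ 4 + 2 * e * e ^ 2) := by
    have h1 := mul_le_mul_of_nonneg_left b3 hT.le
    have h2 := mul_le_mul_of_nonneg_left b4 hT.le
    have h3 := mul_le_mul_of_nonneg_left hh3 hT.le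
    linarith
  have b6 := mul_le_mul_of_nonneg_left b5 hK.le
  have b7 : K * T * (2 * e * e ^ 2) ≤ c / 2 * e ^ 2 := by
    have := mul_le_mul_of_nonneg_right heδ' (sq_nonneg e)
    linarith
  have b8 : 0 ≤ K * T * ((2 + K * T) * (h ^ 2 * e) + (3 + l + K * l) * h ^ 4) := by positivity
  have b9 : K * T * ((3 + l + K * l) * (h ^ 2 * e) + (2 + K * T) * h ^ 4) ≤
      W * (h ^ 2 * e + h ^ 4) := by
    rw [hW]; linarith
  linarith

end LocalMax

/-! ### Perturbation of μ -/

section Mu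

open scoped Matrix.Norms.Elementwise

variable {p m : ℕ} {Γ : ℝ}

theorem mu_le (M : Matrix (Fin p) (Fin m) ℂ) {γ : ℝ} (hγ : γ ∈ Set.Icc Γ 1) :
    mu Γ M ≤ sigma (blockT M γ) 2 :=
  csInf_le ⟨0, by rintro _ ⟨t, _, rfl⟩; exact LinearMap.singularValues_nonneg _ _⟩ ⟨γ, hγ, rfl⟩

theorem exists_sigma_two_eq_mu (hΓ : Γ ∈ Set.Ioo (0 : ℝ) 1) (M : Matrix (Fin p) (Fin m) ℂ) :
    ∃ γ ∈ Set.Icc Γ 1, sigma (blockT M γ) 2 = mu Γ M := by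
  obtain ⟨γ, hγ, hmin⟩ := isCompact_Icc.exists_isMinOn (Set.nonempty_Icc.2 hΓ.2.le)
    (continuousOn_sigma_two_blockT M hΓ.1)
  refine ⟨γ, hγ, le_antisymm (le_csInf ⟨_, γ, hγ, rfl⟩ ?_) (mu_le M hγ)⟩
  rintro _ ⟨t, ht, rfl⟩
  exact hmin ht

theorem norm_blockT_sub_le (hΓ : Γ ∈ Set.Ioo (0 : ℝ) 1) (M N : Matrix (Fin p) (Fin m) ℂ) {γ : ℝ}
    (hγ : γ ∈ Set.Icc Γ 1) : ‖blockT M γ - blockT N γ‖ ≤ Γ⁻¹ * ‖M - N‖ := by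
  have hγ0 : 0 < γ := hΓ.1.trans_le hγ.1
  have h1 : 1 ≤ Γ⁻¹ := (one_le_inv₀ hΓ.1).2 hΓ.2.le
  have h2 : γ⁻¹ ≤ Γ⁻¹ := inv_anti₀ hΓ.1 hγ.1
  have h0 : 0 ≤ Γ⁻¹ := by linarith
  have hent : ∀ i j, ‖M i j - N i j‖ ≤ ‖M - N‖ := fun i j =>
    (M - N).norm_entry_le_entrywise_sup_norm
  have hre : ∀ i j, |(M i j).re - (N i j).re| ≤ ‖M - N‖ := fun i j =>
    (Complex.abs_re_le_norm (M i j - N i j)).trans (hent i j)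
  have him : ∀ i j, |(M i j).im - (N i j).im| ≤ ‖M - N‖ := fun i j =>
    (Complex.abs_im_le_norm (M i j - N i j)).trans (hent i j)
  have hre' : ∀ i j, |(M i j).re - (N i j).re| ≤ Γ⁻¹ * ‖M - N‖ := fun i j =>
    (hre i j).trans (le_mul_of_one_le_left (norm_nonneg _) h1)
  rw [Matrix.norm_le_iff (by positivity)]
  intro i j
  rw [Real.norm_eq_abs]
  rcases i with i | i <;> rcases j with j | j
  · exact hre' i j
  · change |-(γ * (M i j).im) - -(γ * (N i j).im)| ≤ _
    rw [show -(γ * (M i j).im) - -(γ * (N i j).im) = -γ * ((M i j).im - (N i j).im) by ring,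
      abs_mul, abs_neg, abs_of_pos hγ0]
    exact mul_le_mul (hγ.2.trans h1) (him i j) (abs_nonneg _) h0
  · change |γ⁻¹ * (M i j).im - γ⁻¹ * (N i j).im| ≤ _
    rw [← mul_sub, abs_mul, abs_of_pos (inv_pos.2 hγ0)]
    exact mul_le_mul h2 (him i j) (abs_nonneg _) h0
  · exact hre' i j

theorem exists_lipschitz_sigma_two_blockT (hΓ : Γ ∈ Set.Ioo (0 : ℝ) 1) (p m : ℕ) :
    ∃ L > (0 : ℝ), ∀ (M N : Matrix (Fin p) (Fin m) ℂ), ∀ γ ∈ Set.Icc Γ 1,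
      sigma (blockT M γ) 2 ≤ sigma (blockT N γ) 2 + L * ‖M - N‖ := by
  obtain ⟨L, hL, h⟩ := exists_lipschitz_sigma_two (a := Fin p ⊕ Fin p) (b := Fin m ⊕ Fin m)
  refine ⟨L * Γ⁻¹, mul_pos hL (inv_pos.2 hΓ.1), fun M N γ hγ => ?_⟩
  have h1 := (le_abs_self _).trans (h (blockT M γ) (blockT N γ))
  have h2 := mul_le_mul_of_nonneg_left (norm_blockT_sub_le hΓ M N hγ) hL.le
  linarith

theorem exists_lipschitz_mu (hΓ : Γ ∈ Set.Ioo (0 : ℝ) 1) (p m : ℕ) :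
    ∃ L > (0 : ℝ), ∀ (M N : Matrix (Fin p) (Fin m) ℂ), mu Γ M ≤ mu Γ N + L * ‖M - N‖ := by
  obtain ⟨L, hL, h⟩ := exists_lipschitz_sigma_two_blockT hΓ p m
  refine ⟨L, hL, fun M N => ?_⟩
  obtain ⟨γ, hγ, heq⟩ := exists_sigma_two_eq_mu hΓ N
  rw [← heq]
  exact (mu_le M hγ).trans (h M N γ hγ)

theorem continuous_mu (hΓ : Γ ∈ Set.Ioo (0 : ℝ) 1) :
    Continuous fun M : Matrix (Fin p) (Fin m) ℂ => mu Γ M := by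
  obtain ⟨L, hL, h⟩ := exists_lipschitz_mu hΓ p m
  refine (LipschitzWith.of_dist_le_mul (K := L.toNNReal) fun M N => ?_).continuous
  rw [Real.dist_eq, dist_eq_norm, Real.coe_toNNReal _ hL.le, abs_le]
  have h1 := h M N
  have h2 := h N M
  rw [norm_sub_rev] at h2
  constructor <;> linarith

/-- A comparison of maximal values of `μ` for perturbed data: if the perturbation at `M₀` is
`F`, that at `M₁` is `E`, and the perturbed value at `M₁` is the larger one, then `μ` at `M₁` is
not much smaller than at `M₀`. -/
theorem exists_mu_sub_le (hΓ : Γ ∈ Set.Ioo (0 : ℝ) 1) {M₀ : Matrix (Fin p) (Fin m) ℂ} {γs : ℝ}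
    (hγs : γs ∈ Set.Icc Γ 1)
    (hmin : ∀ γ ∈ Set.Icc Γ 1, γ ≠ γs → sigma (blockT M₀ γs) 2 < sigma (blockT M₀ γ) 2)
    (hsimple : IsSimpleSingularValue (blockT M₀ γs) 2) :
    ∃ K > (0 : ℝ), ∃ η > (0 : ℝ), ∀ M₁ E F : Matrix (Fin p) (Fin m) ℂ,
      ‖M₁ - M₀‖ < η → ‖E - F‖ < η → ‖F‖ < η → mu Γ (M₀ + F) ≤ mu Γ (M₁ + E) →
      ∃ t₀ t₁ : ℝ, t₀ ^ 2 ≤ K * ‖F‖ ∧ t₁ ^ 2 ≤ K * ‖M₁ - M₀‖ ∧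
        mu Γ M₀ - mu Γ M₁ ≤ K * (‖E - F‖ + ‖F‖ * (‖M₁ - M₀‖ + |t₀| + |t₁|)) := by
  obtain ⟨L, hL, hLip⟩ := exists_lipschitz_sigma_two_blockT hΓ p m
  obtain ⟨α, hα, hgrow⟩ := exists_quadratic_growth hΓ.1 hγs hmin hsimple
  obtain ⟨K₄, hK₄, ρ, hρ, hfour⟩ := exists_four_point_bound
    (contDiffAt_sigma_two_blockT (hΓ.1.trans_le hγs.1) hγs.2 hsimple)
  -- A minimizer for N has a value at most 2L‖N - M₀‖ above the minimum for M₀, and quadratic growth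
  -- turns this into a bound on its squared distance to `γs`. `M` enters only through its norm.
  have near : ∀ (M N : Matrix (Fin p) (Fin m) ℂ) (γ : ℝ), γ ∈ Set.Icc Γ 1 →
      sigma (blockT N γ) 2 = mu Γ N → ‖N - M₀‖ ≤ ‖M‖ →
      (γ - γs) ^ 2 ≤ 2 * L / α * ‖M‖ := fun M N γ hγ heq hN => by
    have h1 := hgrow γ hγ
    have h2 := hLip M₀ N γ hγ
    have h3 := hLip N M₀ γs hγs
    have h4 := mu_le N hγs
    rw [norm_sub_rev] at h2
    have h5 : L * ‖N - M₀‖ ≤ L * ‖M‖ := by gcongr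
    rw [div_mul_eq_mul_div, le_div_iff₀ hα]
    linarith
  have hκ : 0 < 2 * L / α := by positivity
  set κ := 2 * L / α with hκdef
  -- ρ/3 leaves room for the sum of the three matrix perturbations, and ρ²/κ keeps both minimizers
  -- within ρ of `γs`.
  refine ⟨K₄ + κ, by positivity, min (ρ / 3) (ρ ^ 2 / κ), by positivity, ?_⟩
  intro M₁ E F hM hE hF hle
  obtain ⟨γ₁, hγ₁, heq₁⟩ := exists_sigma_two_eq_mu hΓ M₁
  obtain ⟨γ₀, hγ₀, heq₀⟩ := exists_sigma_two_eq_mu hΓ (M₀ + F)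
  have ht₁ := near (M₁ - M₀) M₁ γ₁ hγ₁ heq₁ le_rfl
  have ht₀ := near F (M₀ + F) γ₀ hγ₀ heq₀ (by rw [add_sub_cancel_left])
  have hMρ := hM.trans_le (min_le_left _ _)
  have hEρ := hE.trans_le (min_le_left _ _)
  have hFρ := hF.trans_le (min_le_left _ _)
  have hsq : ∀ t s : ℝ, t ^ 2 ≤ κ * s → s < min (ρ / 3) (ρ ^ 2 / κ) → |t| < ρ := fun t s h1 h2 => by
    have h3 := h2.trans_le (min_le_right _ _)
    rw [lt_div_iff₀ hκ] at h3
    exact abs_lt_of_sq_lt_sq (by linarith) hρ.le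
  have hγ₁ρ := hsq _ _ ht₁ hM
  have hγ₀ρ := hsq _ _ ht₀ hF
  have hball : ∀ (N : Matrix (Fin p) (Fin m) ℂ) (γ : ℝ), ‖N - M₀‖ < ρ → |γ - γs| < ρ →
      (N, γ) ∈ Metric.ball (M₀, γs) ρ := fun N γ h1 h2 => by
    rw [mem_ball_iff_norm, Prod.mk_sub_mk, Prod.norm_mk]
    exact max_lt h1 h2
  have hME : ‖M₁ + E - M₀‖ < ρ := by
    have h1 : M₁ + E - M₀ = (M₁ - M₀) + ((E - F) + F) := by abel
    rw [h1]
    have h2 := norm_add_le (M₁ - M₀) ((E - F) + F)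
    have h3 := norm_add_le (E - F) F
    linarith
  -- Both increments are taken at fixed γ, so the steps are (E, 0) and (F, 0), and γ enters only
  -- through the distance of the base points.
  have key := hfour (M₁, γ₁) (M₀, γ₀) (E, 0) (F, 0) (hball _ _ (by linarith) hγ₁ρ)
    (hball _ _ (by simpa using hρ) hγ₀ρ)
    (by rw [Prod.mk_add_mk, add_zero]; exact hball _ _ hME hγ₁ρ)
    (by
      rw [Prod.mk_add_mk, add_zero]
      exact hball _ _ (by rw [add_sub_cancel_left]; linarith) hγ₀ρ)
  simp only [Prod.mk_add_mk, add_zero, Prod.mk_sub_mk, sub_self, Prod.norm_mk, norm_zero,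
    Real.norm_eq_abs] at key
  rw [max_eq_left (norm_nonneg _), max_eq_left (norm_nonneg _)] at key
  have hmax : max ‖M₁ - M₀‖ |γ₁ - γ₀| ≤ ‖M₁ - M₀‖ + |γ₀ - γs| + |γ₁ - γs| := by
    refine max_le (by linarith [abs_nonneg (γ₀ - γs), abs_nonneg (γ₁ - γs)]) ?_
    rw [show γ₁ - γ₀ = (γ₁ - γs) - (γ₀ - γs) by ring]
    linarith [abs_sub (γ₁ - γs) (γ₀ - γs), norm_nonneg (M₁ - M₀)]
  refine ⟨γ₀ - γs, γ₁ - γs, ht₀.trans ?_, ht₁.trans ?_, ?_⟩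
  · gcongr; linarith
  · gcongr; linarith
  -- `γ₀` is optimal for M₀ + F and merely admissible for M₀, while `γ₁` is optimal for M₁ and
  -- merely admissible for M₁ + E, so all four inequalities point the same way.
  · have h1 := mu_le M₀ hγ₀
    have h2 := mu_le (M₁ + E) hγ₁
    have h3 : K₄ * (‖E - F‖ + ‖F‖ * max ‖M₁ - M₀‖ |γ₁ - γ₀|) ≤
        (K₄ + κ) * (‖E - F‖ + ‖F‖ * (‖M₁ - M₀‖ + |γ₀ - γs| + |γ₁ - γs|)) := by
      gcongr
      linarith
    linarith

end Mu

/-! ### One step of the method -/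

open scoped Matrix.Norms.Elementwise in
-- Orthonormality, interpolation at the previous iterate and maximality are all that a step needs
-- from the run. Quantifying over every such `V` after the constants makes them independent of the
-- run and of k.
theorem exists_quadratic_convergence {n m p : ℕ} {A : Matrix (Fin n) (Fin n) ℂ}
    (hA : ∀ ω, IsUnit (shifted A ω)) (B : Matrix (Fin n) (Fin m) ℂ)
    (C : Matrix (Fin p) (Fin n) ℂ) {Γ : ℝ} (hΓ : Γ ∈ Set.Ioo (0 : ℝ) 1) {β : ℝ} (hβ : 0 < β)
    {ωs γs : ℝ} (hmax : IsLocalMax (fun ω => mu Γ (transfer A B C ω)) ωs)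
    (hγs : γs ∈ Set.Icc Γ 1)
    (hmin : ∀ γ ∈ Set.Icc Γ 1, γ ≠ γs →
      sigma (blockT (transfer A B C ωs) γs) 2
        < sigma (blockT (transfer A B C ωs) γ) 2)
    (hsimple :
      IsSimpleSingularValue (blockT (transfer A B C ωs) γs) 2)
    (hsecond :
      iteratedDeriv 2 (fun ω => mu Γ (transfer A B C ω)) ωs ≠ 0) :
    ∃ c > (0 : ℝ), ∃ δ > (0 : ℝ),
      ∀ (r : ℕ) (V : Matrix (Fin n) (Fin r) ℂ) (ω' ω : ℝ), Vᴴ * V = 1 →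
        (∀ j ∈ Finset.Icc 1 3, V * (Vᴴ * ((shifted A ω')⁻¹ ^ j * B)) =
          (shifted A ω')⁻¹ ^ j * B) →
        IsReducedMaximizer Γ A B C V ω →
        β ≤ sigmaMin (shifted (projA A V) ωs) →
        |ω' - ωs| < δ → |ω - ωs| < δ → |ω - ωs| ≤ c * |ω' - ωs| ^ 2 := by
  set H := transfer A B C with hH
  obtain ⟨lH, hlH, δ₁, hδ₁, hlip⟩ := exists_lipschitz_transfer hA B C ωs
  obtain ⟨T, hT, δ₂, hδ₂, herr⟩ := exists_transfer_error_bounds hA B C ωs hβ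
  have hHlip : ∀ ω, |ω - ωs| < δ₁ → ‖H ω - H ωs‖ ≤ lH * |ω - ωs| := fun ω hω => by
    rw [Matrix.norm_le_iff (by positivity)]
    exact hlip ω hω
  have hHcont : ContinuousAt H ωs := by
    have h0 : Tendsto (fun ω => lH * |ω - ωs|) (𝓝 ωs) (𝓝 0) := by
      have : Continuous fun ω : ℝ => lH * |ω - ωs| := by fun_prop
      simpa using this.tendsto ωs
    refine tendsto_iff_norm_sub_tendsto_zero.2 (squeeze_zero' (Eventually.of_forall fun _ => norm_nonneg _) ?_ h0)
    filter_upwards [Metric.ball_mem_nhds ωs hδ₁] with ω hω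
    exact hHlip ω (by rwa [mem_ball_iff_norm, Real.norm_eq_abs] at hω)
  obtain ⟨c₀, hc₀, hdecay⟩ := exists_quadratic_decay hmax
    (ContinuousAt.comp (f := H) (continuous_mu hΓ).continuousAt hHcont) hsecond
  obtain ⟨δ₃, hδ₃, hdecay⟩ := Metric.eventually_nhds_iff_ball.1 hdecay
  obtain ⟨K, hK, η, hη, hcomp⟩ := exists_mu_sub_le hΓ hγs hmin hsimple
  obtain ⟨c, hc, δ₄, hδ₄, hrate⟩ := exists_quadratic_rate hc₀ hK hT hlH
  have hsmall : ∀ᶠ δ in 𝓝[>] (0 : ℝ), lH * δ < η ∧ T * δ ^ 3 < η ∧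
      T * (δ + δ) ^ 2 * δ + T * δ ^ 3 * δ < η := by
    have e1 : Continuous fun δ : ℝ => lH * δ := by fun_prop
    have e2 : Continuous fun δ : ℝ => T * δ ^ 3 := by fun_prop
    have e3 : Continuous fun δ : ℝ => T * (δ + δ) ^ 2 * δ + T * δ ^ 3 * δ := by fun_prop
    have f1 := (e1.tendsto 0).eventually_lt_const (u := η) (by simpa using hη)
    have f2 := (e2.tendsto 0).eventually_lt_const (u := η) (by simpa using hη)
    have f3 := (e3.tendsto 0).eventually_lt_const (u := η) (by simpa using hη)
    exact (f1.and (f2.and f3)).filter_mono nhdsWithin_le_nhds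
  have hmin4 : 0 < min (min δ₁ δ₂) (min δ₃ δ₄) := by positivity
  obtain ⟨δ, ⟨⟨s1, s2, s3⟩, hδlt⟩, hδ⟩ := ((hsmall.and
    ((eventually_lt_nhds hmin4).filter_mono nhdsWithin_le_nhds)).and self_mem_nhdsWithin).exists
  have hδ0 : 0 < δ := hδ
  simp only [lt_min_iff] at hδlt
  obtain ⟨⟨d1, d2⟩, d3, d4⟩ := hδlt
  refine ⟨c, hc, δ, hδ0, fun r V ω' ω hV hN hmaxV hσ hω' hω => ?_⟩
  -- The lower bound `β` puts `ωs` in the domain of the reduced function, so the maximizer may be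
  -- compared with it.
  obtain ⟨hUs, -⟩ := isUnit_and_norm_inv_le_of_le_sigmaMin hβ hσ
  obtain ⟨g1, g2⟩ := herr r V ω' ω hV hN hσ hmaxV.1 (hω'.trans d2) (hω.trans d2)
  set h := |ω' - ωs| with hh
  set e := |ω - ωs| with he
  have hh0 : 0 ≤ h := abs_nonneg _
  have he0 : 0 ≤ e := abs_nonneg _
  set F := reducedTransfer A B C V ωs - H ωs with hF
  set E := reducedTransfer A B C V ω - H ω with hE
  have hFn : ‖F‖ ≤ T * h ^ 3 := (Matrix.norm_le_iff (by positivity)).2 g1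
  have hEF : ‖E - F‖ ≤ T * (h + e) ^ 2 * e + T * h ^ 3 * e :=
    (Matrix.norm_le_iff (by positivity)).2 g2
  have hHn := hHlip ω (hω.trans d1)
  have hHη : ‖H ω - H ωs‖ < η := hHn.trans_lt (lt_of_le_of_lt (by gcongr) s1)
  have hFη : ‖F‖ < η := hFn.trans_lt (lt_of_le_of_lt (by gcongr) s2)
  have hEFη : ‖E - F‖ < η := hEF.trans_lt (lt_of_le_of_lt (by gcongr) s3)
  obtain ⟨t₀, t₁, ht₀, ht₁, hle⟩ := hcomp (H ω) E F hHη hEFη hFη (by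
    rw [hF, hE, add_sub_cancel, add_sub_cancel]
    exact hmaxV.2 ωs hUs)
  have hdec := hdecay ω (by rw [mem_ball_iff_norm, Real.norm_eq_abs]; exact hω.trans d3)
  refine hrate h e ‖F‖ ‖E - F‖ ‖H ω - H ωs‖ t₀ t₁ hh0 (hω'.trans d4) he0 (hω.trans d4) hFn hEF
    (norm_nonneg _) hHn ht₀ ht₁ ?_
  rw [he, sq_abs]
  exact hdec.trans hle

end StabRadius
end

theorem mainTheorem1 {n m p : ℕ} (A : Matrix (Fin n) (Fin n) ℝ) (B : Matrix (Fin n) (Fin m) ℝ)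
    (C : Matrix (Fin p) (Fin n) ℝ) (hA : StabRadius.IsHurwitz A)
    (H : ℝ → Matrix (Fin p) (Fin m) ℂ)
    (hH : H = StabRadius.transfer (StabRadius.toC A) (StabRadius.toC B) (StabRadius.toC C))
    (Γ : ℝ) (hΓ : Γ ∈ Set.Ioo (0 : ℝ) 1) (β : ℝ) (hβ : 0 < β)
    (ωs γs : ℝ)
    (hmax : IsLocalMax (fun ω => StabRadius.mu Γ (H ω)) ωs)
    (hγs : γs ∈ Set.Icc Γ 1)
    (hmin : ∀ γ ∈ Set.Icc Γ 1, γ ≠ γs →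
      StabRadius.sigma (StabRadius.blockT (H ωs) γs) 2
        < StabRadius.sigma (StabRadius.blockT (H ωs) γ) 2)
    (hsimple : StabRadius.IsSimpleSingularValue (StabRadius.blockT (H ωs) γs) 2)
    (hsecond : iteratedDeriv 2 (fun ω => StabRadius.mu Γ (H ω)) ωs ≠ 0) :
    ∃ c > (0 : ℝ), ∃ δ > (0 : ℝ),
      ∀ (N : ℕ) (r : ℕ → ℕ) (V : (k : ℕ) → Matrix (Fin n) (Fin (r k)) ℂ) (ω : ℕ → ℝ),
        StabRadius.IsSubspaceRun Γ (StabRadius.toC A) (StabRadius.toC B) (StabRadius.toC C)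
          N r V ω →
        ∀ k, 1 ≤ k → k ≤ N →
          β ≤ StabRadius.sigmaMin
            (StabRadius.shifted (StabRadius.projA (StabRadius.toC A) (V k)) ωs) →
          |ω k - ωs| < δ → |ω (k + 1) - ωs| < δ →
          |ω (k + 1) - ωs| ≤ c * |ω k - ωs| ^ 2 := by
  subst hH
  obtain ⟨c, hc, δ, hδ, hconv⟩ := StabRadius.exists_quadratic_convergence
    (StabRadius.isUnit_shifted_of_isHurwitz hA) (StabRadius.toC B) (StabRadius.toC C) hΓ hβ hmax
    hγs hmin hsimple hsecond
  refine ⟨c, hc, δ, hδ, fun N r V ω hrun k hk hkN hσ hω hω' => ?_⟩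
  obtain ⟨hV, hN⟩ := hrun.orthonormal_and_interpolates hk hkN
  exact hconv (r k) (V k) (ω k) (ω (k + 1)) hV hN (hrun.maximize k hk hkN) hσ hω hω'
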